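/- Let $k$ be a field and let $\mathcal C$ be an additive $k$-category which is Hom-finite (all morphism spaces are finite dimensional over $k$) and Krull-Schmidt (every non-zero object is a finite direct sum of objects with local endomorphism algebras). **Auslander-Reiten quiver.** Let $\mathrm{rad}(X,Y)$ be the Jacobson radical of $\mathcal C$, $\mathrm{rad}^2$ its square, $\mathrm{irr}(X,Y)=\mathrm{rad}(X,Y)/\mathrm{rad}^2(X,Y)$, and for $X$ indecomposable let $k_X=\mathrm{End}(X)/\mathrm{rad}(X,X)$ be its automorphism field; it is called trivial if it is $k$. A morphism $f:X\to Y$ is a source morphism if it is not a section, every non-section $X\to M$ factors through $f$, and every $h\in\mathrm{End}(Y)$ with $hf=f$ is an automorphism; sink morphisms are defined dually. A sequence $X\xrightarrow{f}Y\xrightarrow{g}Z$ with $Y\neq0$ is almost split if $f$ is a source morphism and a pseudo-kernel of $g$, and $g$ is a sink morphism and a pseudo-cokernel of $f$ (pseudo: the factorization need not be unique). The Auslander-Reiten quiver $\Gamma_{\mathcal C}$ has as vertices a complete set of representatives of the isomorphism classes of indecomposable objects. With $d_{XY}=\dim_{k_Y}\mathrm{irr}(X,Y)$ and $d'_{XY}=\dim_{k_X}\mathrm{irr}(X,Y)$,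 there are $d_{XY}$ unvalued arrows $X\to Y$ if $d_{XY}=d'_{XY}$, and a single arrow with valuation $(d_{XY},d'_{XY})$ otherwise. The translation $\tau$ is given by $\tau Z=X$ if and only if there is an almost split sequence $X\to Y\to Z$. **Standard subquivers.** A full subquiver is convex if it contains every vertex on every path between two of its vertices. Let $\Sigma$ be a convex full subquiver of $\Gamma_{\mathcal C}$, and let $\mathcal C(\Sigma)$ be the full subcategory of $\mathcal C$ whose objects are the vertices of $\Sigma$. If all objects of $\Sigma$ have trivial automorphism field, the mesh category $k(\Sigma)$ is the quotient of the path category $k\Sigma$ by the ideal generated by the mesh relations $\sum_\beta \beta\,\sigma(\beta)$, one for each $Z$ with $Z,\tau Z\in\Sigma$, where $\beta:Y\to Z$ runs over the arrows ending in $Z$ and, for each $Y$, $\sigma$ is a bijection from the arrows $Y\to Z$ to the arrows $\tau Z\to Y$. One says that $\Sigma$ is standard if every object of $\Sigma$ has trivial automorphism field and, for some choice of the bijections $\sigma$, there is a $k$-linear equivalence $k(\Sigma)\to\mathcal C(\Sigma)$ which is the identity on objects. **Sections.** Let $\Gamma$ be a connected component of $\Gamma_{\mathcal C}$. A section of $\Gamma$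 is a connected full subquiver $\Delta$ which is convex in $\Gamma$, contains no oriented cycle, and meets every $\tau$-orbit of $\Gamma$ exactly once. Let $\Delta^-$ (respectively $\Delta^+$) be the full subquiver of $\Gamma$ on the vertices $\tau^nX$ with $X\in\Delta$ and $n>0$ (respectively $n<0$). **Theorem.** Let $\Gamma$ be a connected component of $\Gamma_{\mathcal C}$ with a section $\Delta$. Assume that $\Delta^+$ has no left infinite path $\cdots\to X_2\to X_1\to X_0$ and that $\Delta^-$ has no right infinite path $X_0\to X_1\to X_2\to\cdots$. Then $\Gamma$ is standard if and only if $\Delta$ is standard, $\mathrm{Hom}_{\mathcal C}(X,Y)=0$ for all $X\in\Delta^+$ and $Y\in\Delta\cup\Delta^-$, and $\mathrm{Hom}_{\mathcal C}(X,Y)=0$ for all $X\in\Delta$ and $Y\in\Delta^-$. -/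

import Mathlib

open CategoryTheory CategoryTheory.Limits

universe w v u

namespace ARTheory

/-! ### Krull-Schmidt categories, radical, automorphism fields -/

section Basics

variable (k : Type w) [Field k] {C : Type u} [Category.{v} C] [Preadditive C] [Linear k C]

/-- All morphism spaces are finite dimensional over `k`. -/
def HomFinite (C : Type u) [Category.{v} C] [Preadditive C] [Linear k C] : Prop :=
  ∀ X Y : C, Module.Finite k (X ⟶ Y)

/-- Every non-zero object is a finite direct sum of objects with a local endomorphism algebra. -/
def KrullSchmidt (C : Type u) [Category.{v} C] [Preadditive C] [HasFiniteBiproducts C] : Prop :=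
  ∀ X : C, ¬ IsZero X → ∃ (n : ℕ) (Y : Fin n → C),
    (∀ i, IsLocalRing (End (Y i))) ∧ Nonempty (X ≅ ⨁ Y)

/-- The Jacobson radical `rad(X, Y)` of the category. -/
def rad (X Y : C) : Submodule k (X ⟶ Y) where
  carrier := {f | ∀ g : Y ⟶ X, IsIso (𝟙 X - f ≫ g)}
  zero_mem' := by
    intro g
    rw [zero_comp, sub_zero]
    infer_instance
  add_mem' := by
    intro f₁ f₂ h₁ h₂ g
    have := h₁ g
    have := h₂ (g ≫ inv (𝟙 X - f₁ ≫ g))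
    have e : 𝟙 X - (f₁ + f₂) ≫ g
        = (𝟙 X - f₂ ≫ g ≫ inv (𝟙 X - f₁ ≫ g)) ≫ (𝟙 X - f₁ ≫ g) := by
      rw [Preadditive.sub_comp, Category.assoc, Category.assoc, IsIso.inv_hom_id,
        Category.comp_id, Category.id_comp, Preadditive.add_comp]
      abel
    rw [e]
    infer_instance
  smul_mem' := by
    intro a f h g
    have := h (a • g)
    rwa [Linear.comp_smul, ← Linear.smul_comp] at this

/-- The square `rad²(X, Y)` of the radical. -/
def radSq (X Y : C) : Submodule k (X ⟶ Y) :=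
  Submodule.span k {h | ∃ (Z : C) (f : X ⟶ Z) (g : Z ⟶ Y),
    f ∈ rad k X Z ∧ g ∈ rad k Z Y ∧ h = f ≫ g}

/-- `dim_k irr(X, Y)`, where `irr(X, Y) = rad(X, Y) / rad²(X, Y)`. -/
noncomputable def irrDim (X Y : C) : ℕ :=
  Module.finrank k (↥(rad k X Y) ⧸ (radSq k X Y).submoduleOf (rad k X Y))

/-- `dim_k k_X`, where `k_X = End(X) / rad(X, X)` is the automorphism field of `X`. -/
noncomputable def autDim (X : C) : ℕ :=
  Module.finrank k ((X ⟶ X) ⧸ rad k X X)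

/-- The automorphism field of `X` is trivial, that is, it is `k`. -/
def TrivialAutField (X : C) : Prop := autDim k X = 1

/-! ### Almost split sequences -/

/-- `f : X ⟶ Y` is left almost split and left minimal. -/
def IsSourceMorphism {X Y : C} (f : X ⟶ Y) : Prop :=
  (¬ IsSplitMono f ∧ ∀ (M : C) (g : X ⟶ M), ¬ IsSplitMono g → ∃ h : Y ⟶ M, f ≫ h = g) ∧
    ∀ h : Y ⟶ Y, f ≫ h = f → IsIso h

/-- `g : Y ⟶ Z` is right almost split and right minimal. -/
def IsSinkMorphism {Y Z : C} (g : Y ⟶ Z) : Prop :=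
  (¬ IsSplitEpi g ∧ ∀ (M : C) (f : M ⟶ Z), ¬ IsSplitEpi f → ∃ h : M ⟶ Y, h ≫ g = f) ∧
    ∀ h : Y ⟶ Y, h ≫ g = g → IsIso h

def IsPseudoKernel {X Y Z : C} (f : X ⟶ Y) (g : Y ⟶ Z) : Prop :=
  f ≫ g = 0 ∧ ∀ (W : C) (h : W ⟶ Y), h ≫ g = 0 → ∃ l : W ⟶ X, l ≫ f = h

def IsPseudoCokernel {X Y Z : C} (f : X ⟶ Y) (g : Y ⟶ Z) : Prop :=
  f ≫ g = 0 ∧ ∀ (W : C) (h : Y ⟶ W), f ≫ h = 0 → ∃ l : Z ⟶ W, g ≫ l = h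

/-- `X ⟶ Y ⟶ Z` is an almost split sequence. -/
def IsAlmostSplitSequence {X Y Z : C} (f : X ⟶ Y) (g : Y ⟶ Z) : Prop :=
  ¬ IsZero Y ∧ IsSourceMorphism f ∧ IsPseudoKernel f g ∧ IsSinkMorphism g ∧ IsPseudoCokernel f g

/-- `X = τ Z`: there is an almost split sequence from `X` to `Z`. -/
def IsTau (X Z : C) : Prop :=
  ∃ (Y : C) (f : X ⟶ Y) (g : Y ⟶ Z), IsAlmostSplitSequence f g

/-! ### The Auslander-Reiten quiver -/

/-- Indecomposable objects: non-zero, and not the direct sum of two non-zero objects. -/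
def IsIndec [HasFiniteBiproducts C] (X : C) : Prop :=
  haveI := hasBinaryBiproducts_of_finite_biproducts C
  Indecomposable X

/-- `ind` is a complete set of representatives of the isomorphism classes of indecomposable
objects, that is, a vertex set of the Auslander-Reiten quiver. -/
def IsVertexSet [HasFiniteBiproducts C] (ind : Set C) : Prop :=
  (∀ X ∈ ind, IsIndec X) ∧
    ∀ X : C, IsIndec X → ∃! Y : C, Y ∈ ind ∧ Nonempty (X ≅ Y)

/-- The dimension `d_{XY}` of `irr(X, Y)` over `k_Y`; the `k`-dimension of a `k_Y`-space is
`dim_k k_Y` times its `k_Y`-dimension. -/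
noncomputable def valRight (X Y : C) : ℕ := irrDim k X Y / autDim k Y

/-- The dimension `d'_{XY}` of `irr(X, Y)` over `k_X`. -/
noncomputable def valLeft (X Y : C) : ℕ := irrDim k X Y / autDim k X

/-- The number of arrows `X → Y` in the Auslander-Reiten quiver: `d_{XY}` (possibly zero) if the
valuation is symmetric, and a single (valued) arrow otherwise. -/
noncomputable def numArrows (X Y : C) : ℕ :=
  if valRight k X Y = valLeft k X Y then valRight k X Y else 1

/-- The full subquiver `S` has an arrow `X → Y`. -/
def ArrowIn (S : Set C) (X Y : C) : Prop := X ∈ S ∧ Y ∈ S ∧ 0 < numArrows k X Y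

/-- `Γ` is (the vertex set of) a connected component of the Auslander-Reiten quiver. -/
def IsComponent (ind Γ : Set C) : Prop :=
  ∃ X ∈ ind, Γ = {Y | Relation.EqvGen (ArrowIn k ind) X Y}

/-! ### Sections -/

/-- The full subquiver `S` is connected (and non-empty). -/
def IsConnectedSubquiver (S : Set C) : Prop :=
  S.Nonempty ∧ ∀ X ∈ S, ∀ Y ∈ S, Relation.EqvGen (ArrowIn k S) X Y

/-- The full subquiver `S` of `Γ` is convex in `Γ`: every vertex on a path of `Γ` between two
vertices of `S` lies in `S`. -/
def IsConvexIn (Γ S : Set C) : Prop :=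
  S ⊆ Γ ∧ ∀ X ∈ S, ∀ Z ∈ S, ∀ Y : C, Relation.ReflTransGen (ArrowIn k Γ) X Y →
    Relation.ReflTransGen (ArrowIn k Γ) Y Z → Y ∈ S

/-- The full subquiver `S` has no oriented cycle. -/
def IsAcyclicSubquiver (S : Set C) : Prop :=
  ∀ X : C, ¬ Relation.TransGen (ArrowIn k S) X X

/-- `Y = τ X` for vertices `X`, `Y` of `Γ`. -/
def TauStep (Γ : Set C) (X Y : C) : Prop := X ∈ Γ ∧ Y ∈ Γ ∧ IsTau Y X

/-- `Y = τⁿ X` for some integer `n`. -/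
def SameTauOrbit (Γ : Set C) (X Y : C) : Prop :=
  Relation.ReflTransGen (TauStep Γ) X Y ∨ Relation.ReflTransGen (TauStep Γ) Y X

/-- The full subquiver of `Γ` with vertex set `Δ` is a section of `Γ`. -/
def IsSection (Γ Δ : Set C) : Prop :=
  IsConnectedSubquiver k Δ ∧ IsConvexIn k Γ Δ ∧ IsAcyclicSubquiver k Δ ∧
    ∀ X ∈ Γ, ∃! Y : C, Y ∈ Δ ∧ SameTauOrbit Γ X Y

/-- The vertices `τⁿ X` with `n > 0` and `X ∈ Δ`. -/
def minusPart (Γ Δ : Set C) : Set C := {Y | ∃ X ∈ Δ, Relation.TransGen (TauStep Γ) X Y}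

/-- The vertices `τⁿ X` with `n < 0` and `X ∈ Δ`. -/
def plusPart (Γ Δ : Set C) : Set C := {Y | ∃ X ∈ Δ, Relation.TransGen (TauStep Γ) Y X}

/-- The full subquiver `S` has a path `⋯ → X₂ → X₁ → X₀`. -/
def HasLeftInfinitePath (S : Set C) : Prop :=
  ∃ p : ℕ → C, ∀ i, ArrowIn k S (p (i + 1)) (p i)

/-- The full subquiver `S` has a path `X₀ → X₁ → X₂ → ⋯`. -/
def HasRightInfinitePath (S : Set C) : Prop :=
  ∃ p : ℕ → C, ∀ i, ArrowIn k S (p i) (p (i + 1))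

/-- `Hom(S, T) = 0`. -/
def HomVanish (S T : Set C) : Prop := ∀ X ∈ S, ∀ Y ∈ T, ∀ f : X ⟶ Y, f = 0

end Basics

/-! ### Path categories and mesh categories -/

section Mesh

variable (k : Type w) [Field k] {V : Type u} [Quiver.{v} V]

/-- The path category `kV` of a quiver `V`. -/
abbrev PathCat (V : Type u) [Quiver.{v} V] := Free k (Paths V)

/-- An arrow, as a morphism of the path category. -/
noncomputable def arrowMap {X Y : V} (a : X ⟶ Y) :
    (Free.of k ((Paths.of V).obj X) : PathCat k V) ⟶ Free.of k ((Paths.of V).obj Y) :=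
  (Free.embedding k (Paths V)).map ((Paths.of V).map a)

/-- Given a translation `τ` on `V` (`tau X Z` means `X = τ Z`), a choice of bijections between the
arrows `Y → Z` and the arrows `τ Z → Y`. In a translation quiver these sets have the same finite
number of elements. If no vertex is `τ`-periodic, then the mesh category below does not depend on
the choice, up to an isomorphism which is the identity on objects. -/
def Polarization (tau : V → V → Prop) : Type (max u v) :=
  ∀ ⦃X Z : V⦄, tau X Z → ∀ Y : V, (Y ⟶ Z) ≃ (X ⟶ Y)

variable {tau : V → V → Prop} (σ : Polarization tau)

/-- The mesh relation `∑ β σ(β)` at `Z`, where `β` runs over the arrows ending in `Z`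
(finitely many if `τ Z` is defined, as then `Z` has a sink morphism). -/
noncomputable def meshElement {X Z : V} (h : tau X Z) :
    (Free.of k ((Paths.of V).obj X) : PathCat k V) ⟶ Free.of k ((Paths.of V).obj Z) :=
  ∑ᶠ b : (Σ Y : V, (Y ⟶ Z)), arrowMap k (σ h b.1 b.2) ≫ arrowMap k b.2

/-- The ideal of the path category generated by the mesh relations. -/
noncomputable def meshIdeal (A B : PathCat k V) : Submodule k (A ⟶ B) :=
  Submodule.span k {m | ∃ (X Z : V) (h : tau X Z)
    (p : A ⟶ Free.of k ((Paths.of V).obj X)) (q : Free.of k ((Paths.of V).obj Z) ⟶ B),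
    m = p ≫ meshElement k σ h ≫ q}

theorem meshIdeal_comp {A B D : PathCat k V} {m : A ⟶ B} (hm : m ∈ meshIdeal k σ A B)
    (r : B ⟶ D) : m ≫ r ∈ meshIdeal k σ A D := by
  induction hm using Submodule.span_induction with
  | mem x hx =>
    obtain ⟨X, Z, h, p, q, rfl⟩ := hx
    exact Submodule.subset_span ⟨X, Z, h, p, q ≫ r, by simp only [Category.assoc]⟩
  | zero => rw [zero_comp]; exact Submodule.zero_mem _
  | add x y _ _ hx hy => rw [Preadditive.add_comp]; exact Submodule.add_mem _ hx hy
  | smul a x _ hx => rw [Linear.smul_comp]; exact Submodule.smul_mem _ a hx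

theorem comp_meshIdeal {A B D : PathCat k V} {m : A ⟶ B} (hm : m ∈ meshIdeal k σ A B)
    (r : D ⟶ A) : r ≫ m ∈ meshIdeal k σ D B := by
  induction hm using Submodule.span_induction with
  | mem x hx =>
    obtain ⟨X, Z, h, p, q, rfl⟩ := hx
    exact Submodule.subset_span ⟨X, Z, h, r ≫ p, q, by simp only [Category.assoc]⟩
  | zero => rw [comp_zero]; exact Submodule.zero_mem _
  | add x y _ _ hx hy => rw [Preadditive.comp_add]; exact Submodule.add_mem _ hx hy
  | smul a x _ hx => rw [Linear.comp_smul]; exact Submodule.smul_mem _ a hx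

/-- Congruence modulo the mesh ideal. -/
def meshRel : HomRel (PathCat k V) := fun A B f g => f - g ∈ meshIdeal k σ A B

instance meshRel_congruence : Congruence (meshRel k σ) where
  equivalence := by
    intro A B
    refine ⟨fun f => ?_, fun {f g} h => ?_, fun {f g h} h₁ h₂ => ?_⟩
    · change f - f ∈ _
      rw [sub_self]; exact Submodule.zero_mem _
    · change g - f ∈ _
      rw [← neg_sub]; exact Submodule.neg_mem _ h
    · change f - h ∈ _
      rw [← sub_add_sub_cancel f g h]; exact Submodule.add_mem _ h₁ h₂
  comp_left := by
    intro A B D f g g' h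
    change f ≫ g - f ≫ g' ∈ _
    rw [← Preadditive.comp_sub]; exact comp_meshIdeal k σ h f
  comp_right := by
    intro A B D f f' g h
    change f ≫ g - f' ≫ g ∈ _
    rw [← Preadditive.sub_comp]; exact meshIdeal_comp k σ h g

/-- The mesh category: the quotient of the path category by the mesh ideal. -/
abbrev MeshCat := CategoryTheory.Quotient (meshRel k σ)

theorem meshRel_add ⦃A B : PathCat k V⦄ (f₁ f₂ g₁ g₂ : A ⟶ B) (h : meshRel k σ f₁ f₂)
    (h' : meshRel k σ g₁ g₂) : meshRel k σ (f₁ + g₁) (f₂ + g₂) := by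
  change f₁ + g₁ - (f₂ + g₂) ∈ _
  rw [add_sub_add_comm]; exact Submodule.add_mem _ h h'

noncomputable instance : Preadditive (MeshCat k σ) :=
  CategoryTheory.Quotient.preadditive _ (meshRel_add k σ)

instance : (CategoryTheory.Quotient.functor (meshRel k σ)).Additive :=
  CategoryTheory.Quotient.functor_additive _ (meshRel_add k σ)

theorem meshRel_smul (a : k) ⦃A B : PathCat k V⦄ (f₁ f₂ : A ⟶ B) (h : meshRel k σ f₁ f₂) :
    meshRel k σ (a • f₁) (a • f₂) := by
  change a • f₁ - a • f₂ ∈ _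
  rw [← smul_sub]; exact Submodule.smul_mem _ a h

noncomputable instance : Linear k (MeshCat k σ) :=
  CategoryTheory.Quotient.linear k _ (meshRel_smul k σ)

/-- A vertex, as an object of the mesh category. -/
def MeshCat.ofVertex (X : V) : MeshCat k σ := ⟨Free.of k ((Paths.of V).obj X)⟩

end Mesh

/-! ### Standard subquivers -/

section Standard

variable (k : Type w) [Field k] {C : Type u} [Category.{v} C] [Preadditive C] [Linear k C]

/-- The vertices of the full subquiver `S` of the Auslander-Reiten quiver. -/
@[ext]
structure Vertex (k : Type w) (S : Set C) : Type u where
  obj : C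
  mem : obj ∈ S

noncomputable instance (S : Set C) : Quiver.{0} (Vertex k S) where
  Hom X Y := Fin (numArrows k X.obj Y.obj)

/-- The translation of `S`: `X = τ Z`, with both `X` and `Z` in `S`. -/
def vertexTau (S : Set C) (X Z : Vertex k S) : Prop := IsTau X.obj Z.obj

/-- The full subcategory of `C` with set of objects `S`. -/
abbrev FullSub (S : Set C) := InducedCategory C (fun X : Vertex k S => X.obj)

/-- A convex full subquiver `S` of the Auslander-Reiten quiver is standard: all its objects have a
trivial automorphism field (so that it is non-valued), and its mesh category is `k`-equivalent to
the full subcategory of `C` on `S` by a functor which acts identically on the objects. -/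
def IsStandard (S : Set C) : Prop :=
  (∀ X ∈ S, TrivialAutField k X) ∧
    ∃ (σ : Polarization (vertexTau k S)) (F : MeshCat k σ ⥤ FullSub k S),
      F.Additive ∧ F.Linear k ∧ F.IsEquivalence ∧
        ∀ X : Vertex k S, F.obj (MeshCat.ofVertex k σ X) = X

end Standard

end ARTheory

/-! By `isStandard_iff`, standardness means that every arrow can be sent to a morphism of the
category in such a way that evaluating linear combinations of paths is onto every Hom space and has
exactly the mesh ideal as kernel. The whole argument is carried out with such choices of images of
arrows.

Necessity is a matter of paths. A mesh contains a path from τZ to Z, so convexity and acyclicity of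
Δ, together with the single intersection with each τ-orbit, forbid paths from Δ⁺ to Δ ∪ Δ⁻ and from
Δ to Δ⁻ (`IsTauSection.mem_plusPart_of_path`, `IsTauSection.mem_minusPart_of_path`). If Γ is
standard, every morphism comes from paths, so the corresponding Hom spaces vanish. Paths between
vertices of Δ stay in Δ, and no mesh fits between two of them; hence the mesh ideal is zero there
and the evaluation on Γ restricts to one for Δ.

For sufficiency, triviality of automorphism fields first spreads from Δ to Γ along almost split
sequences. The images of the arrows of Δ are then extended mesh by mesh. The key point is
`IsSourceMorphism.exists_isIso`: morphisms spanning rad/rad² out of X = τZ differ from the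
components of a source morphism only by an automorphism of the middle term. Absorbing this
automorphism into the sink morphism yields images for the arrows into Z which make the mesh relation
hold exactly and again span rad/rad². The absence of left infinite paths in Δ⁺ makes this a
well-founded recursion; Δ⁻ is dual.

It remains to compare Hom spaces. Across a mesh, an argument in the style of the five lemma
(`EvalBijective.of_mesh_right`, `EvalBijective.of_mesh_left`) carries bijectivity from τZ and the
middle vertices to Z as target, and dually for sources. The assumed vanishing of Hom spaces and the
standardness of Δ start the induction, which first moves the target through Δ⁺ and then the source
through Δ⁻. -/

namespace ARTheory

/-! ### The opposite of a linear category -/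

section Opposite

variable (k : Type w) [Field k] {C : Type u} [Category.{v} C] [Preadditive C] [Linear k C]

instance oppositeLinear : Linear k Cᵒᵖ where
  homModule _ _ :=
    { smul := fun a f => (a • f.unop).op
      one_smul := fun f => Quiver.Hom.unop_inj (one_smul k f.unop)
      mul_smul := fun a b f => Quiver.Hom.unop_inj (mul_smul a b f.unop)
      smul_zero := fun a => Quiver.Hom.unop_inj (smul_zero a)
      smul_add := fun a f g => Quiver.Hom.unop_inj (smul_add a f.unop g.unop)
      add_smul := fun a b f => Quiver.Hom.unop_inj (add_smul a b f.unop)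
      zero_smul := fun f => Quiver.Hom.unop_inj (zero_smul k f.unop) }
  smul_comp _ _ _ a f g := Quiver.Hom.unop_inj (Linear.comp_smul _ _ _ g.unop a f.unop)
  comp_smul _ _ _ f a g := Quiver.Hom.unop_inj (Linear.smul_comp _ _ _ a g.unop f.unop)

/-- Passing to the opposite category, as a linear equivalence on morphism spaces. -/
def opLinearEquiv (X Y : C) : (X ⟶ Y) ≃ₗ[k] (Opposite.op Y ⟶ Opposite.op X) where
  toFun f := f.op
  invFun f := f.unop
  map_add' _ _ := rfl
  map_smul' _ _ := rfl

end Opposite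

/-! ### The radical -/

section Radical

variable {k : Type w} [Field k] {C : Type u} [Category.{v} C] [Preadditive C] [Linear k C]

/-- Jacobson's identity: if u inverts 1 - fg, then 1 + g u f inverts 1 - gf. It makes the one-sided
definition of the radical left-right symmetric. -/
theorem isIso_id_sub_comp_comm {X Y : C} {f : X ⟶ Y} {g : Y ⟶ X} (h : IsIso (𝟙 X - f ≫ g)) :
    IsIso (𝟙 Y - g ≫ f) := by
  have h₁ : inv (𝟙 X - f ≫ g) ≫ f ≫ g = inv (𝟙 X - f ≫ g) - 𝟙 X := by
    have := IsIso.inv_hom_id (𝟙 X - f ≫ g)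
    rw [Preadditive.comp_sub, Category.comp_id] at this
    exact eq_sub_of_add_eq' (sub_eq_iff_eq_add.mp this).symm
  have h₂ : f ≫ g ≫ inv (𝟙 X - f ≫ g) = inv (𝟙 X - f ≫ g) - 𝟙 X := by
    have := IsIso.hom_inv_id (𝟙 X - f ≫ g)
    rw [Preadditive.sub_comp, Category.id_comp, Category.assoc] at this
    exact eq_sub_of_add_eq' (sub_eq_iff_eq_add.mp this).symm
  refine ⟨𝟙 Y + g ≫ inv (𝟙 X - f ≫ g) ≫ f, ?_, ?_⟩
  · have : g ≫ (f ≫ g ≫ inv (𝟙 X - f ≫ g)) ≫ f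
        = g ≫ (inv (𝟙 X - f ≫ g) - 𝟙 X) ≫ f := by rw [h₂]
    simp only [Category.assoc, Preadditive.sub_comp, Preadditive.comp_sub, Category.id_comp] at this
    simp only [Preadditive.sub_comp, Preadditive.comp_add, Category.id_comp, Category.comp_id,
      Category.assoc, this]
    abel
  · have : g ≫ (inv (𝟙 X - f ≫ g) ≫ f ≫ g) ≫ f
        = g ≫ (inv (𝟙 X - f ≫ g) - 𝟙 X) ≫ f := by rw [h₁]
    simp only [Category.assoc, Preadditive.sub_comp, Preadditive.comp_sub, Category.id_comp] at this
    simp only [Preadditive.comp_sub, Preadditive.add_comp, Category.id_comp, Category.comp_id,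
      Category.assoc, this]
    abel

theorem comp_mem_rad {X Y Z : C} (g : X ⟶ Y) {f : Y ⟶ Z} (hf : f ∈ rad k Y Z) :
    g ≫ f ∈ rad k X Z := by
  intro h
  have := isIso_id_sub_comp_comm (g := g) (by simpa using hf (h ≫ g) : IsIso (𝟙 Y - (f ≫ h) ≫ g))
  simpa using this

theorem mem_rad_comp {X Y Z : C} {f : X ⟶ Y} (hf : f ∈ rad k X Y) (g : Y ⟶ Z) :
    f ≫ g ∈ rad k X Z := by
  intro h
  simpa using hf (g ≫ h)

theorem comp_mem_radSq {X Y Z : C} {f : X ⟶ Y} {g : Y ⟶ Z} (hf : f ∈ rad k X Y)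
    (hg : g ∈ rad k Y Z) : f ≫ g ∈ radSq k X Z :=
  Submodule.subset_span ⟨Y, f, g, hf, hg, rfl⟩

theorem mem_rad_iff_op {X Y : C} {f : X ⟶ Y} :
    f.op ∈ rad k (Opposite.op Y) (Opposite.op X) ↔ f ∈ rad k X Y := by
  constructor
  · intro h g
    refine isIso_id_sub_comp_comm ?_
    rw [← isIso_op_iff]
    exact h g.op
  · intro h g
    have := isIso_id_sub_comp_comm (h g.unop)
    rw [← isIso_op_iff] at this
    exact this

theorem mem_radSq_iff_op {X Y : C} {f : X ⟶ Y} :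
    f.op ∈ radSq k (Opposite.op Y) (Opposite.op X) ↔ f ∈ radSq k X Y := by
  have : radSq k (Opposite.op Y) (Opposite.op X)
      = (radSq k X Y).map (opLinearEquiv k X Y).toLinearMap := by
    rw [radSq, radSq, Submodule.map_span]
    congr 1
    ext h
    constructor
    · rintro ⟨Z, f, g, hf, hg, rfl⟩
      exact ⟨g.unop ≫ f.unop, ⟨Z.unop, g.unop, f.unop, mem_rad_iff_op.mp hg, mem_rad_iff_op.mp hf,
        rfl⟩, rfl⟩
    · rintro ⟨_, ⟨Z, f, g, hf, hg, rfl⟩, rfl⟩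
      exact ⟨Opposite.op Z, g.op, f.op, mem_rad_iff_op.mpr hg, mem_rad_iff_op.mpr hf, rfl⟩
  rw [this]
  constructor
  · rintro ⟨g, hg, e⟩
    have : g = f := Quiver.Hom.op_inj e
    rwa [← this]
  · exact fun h => ⟨f, h, rfl⟩

/-- An object with a local endomorphism algebra. -/
structure IsLocalObj (X : C) : Prop where
  id_ne_zero : 𝟙 X ≠ 0
  isIso_or (f : X ⟶ X) : IsIso f ∨ IsIso (𝟙 X - f)

theorem IsLocalObj.op {X : C} (h : IsLocalObj X) : IsLocalObj (Opposite.op X) where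
  id_ne_zero e := h.id_ne_zero (Quiver.Hom.op_inj e)
  isIso_or f := (h.isIso_or f.unop).imp (fun h => (isIso_op_iff _).mpr h)
    (fun h => (isIso_op_iff _).mpr h)

theorem IsLocalObj.of_isLocalRing {X : C} (h : IsLocalRing (End X)) : IsLocalObj X where
  id_ne_zero := one_ne_zero (α := End X)
  isIso_or f := by
    let f' : End X := f
    rcases h.isUnit_or_isUnit_of_add_one (add_sub_cancel f' 1) with h | h
    · exact Or.inl ((isUnit_iff_isIso _).mp h)
    · exact Or.inr ((isUnit_iff_isIso _).mp h)

theorem IsLocalObj.of_iso {X Y : C} (h : IsLocalObj X) (e : X ≅ Y) : IsLocalObj Y where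
  id_ne_zero h' := h.id_ne_zero (by
    have : e.hom ≫ 𝟙 Y ≫ e.inv = 0 := by rw [h']; simp
    simpa using this)
  isIso_or f := by
    rcases h.isIso_or (e.hom ≫ f ≫ e.inv) with h | h
    · left
      have : f = e.inv ≫ (e.hom ≫ f ≫ e.inv) ≫ e.hom := by simp
      rw [this]; infer_instance
    · right
      have : 𝟙 Y - f = e.inv ≫ (𝟙 X - e.hom ≫ f ≫ e.inv) ≫ e.hom := by simp
      rw [this]; infer_instance

/-- If `f ≫ g` were invertible, `f` would be a section; otherwise locality makes `𝟙 X - f ≫ g`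
invertible. -/
theorem IsLocalObj.mem_rad_of_not_isSplitMono {X Y : C} (hX : IsLocalObj X) {f : X ⟶ Y}
    (h : ¬ IsSplitMono f) : f ∈ rad k X Y := by
  intro g
  rcases hX.isIso_or (f ≫ g) with h' | h'
  · exact absurd ⟨⟨g ≫ inv (f ≫ g), by rw [← Category.assoc, IsIso.hom_inv_id]⟩⟩ h
  · exact h'

theorem IsLocalObj.mem_rad_of_not_isSplitEpi {X Y : C} (hY : IsLocalObj Y) {f : X ⟶ Y}
    (h : ¬ IsSplitEpi f) : f ∈ rad k X Y := by
  intro g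
  refine isIso_id_sub_comp_comm ?_
  rcases hY.isIso_or (g ≫ f) with h' | h'
  · exact absurd ⟨⟨inv (g ≫ f) ≫ g, by rw [Category.assoc, IsIso.inv_hom_id]⟩⟩ h
  · exact h'

theorem not_isSplitMono_of_mem_rad {X Y : C} (hX : 𝟙 X ≠ 0) {f : X ⟶ Y} (h : f ∈ rad k X Y) :
    ¬ IsSplitMono f := by
  intro hf
  have := h (retraction f)
  rw [IsSplitMono.id, sub_self] at this
  exact hX (by rw [← cancel_mono (0 : X ⟶ X)]; simp)

theorem not_isSplitEpi_of_mem_rad {X Y : C} (hY : 𝟙 Y ≠ 0) {f : X ⟶ Y} (h : f ∈ rad k X Y) :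
    ¬ IsSplitEpi f := by
  intro hf
  have := isIso_id_sub_comp_comm (h (section_ f))
  rw [IsSplitEpi.id, sub_self] at this
  exact hY (by rw [← cancel_mono (0 : Y ⟶ Y)]; simp)

theorem id_notMem_rad {X : C} (hX : 𝟙 X ≠ 0) : 𝟙 X ∉ rad k X X :=
  fun h => not_isSplitMono_of_mem_rad hX h inferInstance

theorem IsLocalObj.isIso_of_notMem_rad {X Y : C} (hX : IsLocalObj X) (hY : IsLocalObj Y)
    {f : X ⟶ Y} (h : f ∉ rad k X Y) : IsIso f := by
  have h₁ : IsSplitMono f := by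
    by_contra h'
    exact h (hX.mem_rad_of_not_isSplitMono h')
  have h₂ : IsSplitEpi f := by
    by_contra h'
    exact h (hY.mem_rad_of_not_isSplitEpi h')
  exact isIso_of_epi_of_isSplitMono f

theorem smul_id_mem_rad {X : C} (hX : 𝟙 X ≠ 0) {a : k} (h : a • 𝟙 X ∈ rad k X X) : a = 0 := by
  by_contra ha
  exact id_notMem_rad (k := k) hX (by simpa [smul_smul, ha] using (rad k X X).smul_mem a⁻¹ h)

variable (k) in
/-- Every endomorphism is a scalar up to the radical. -/
def ScalarEnd (X : C) : Prop := ∀ f : X ⟶ X, ∃ a : k, f - a • 𝟙 X ∈ rad k X X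

theorem ScalarEnd.op {X : C} (h : ScalarEnd k X) : ScalarEnd k (Opposite.op X) := by
  intro f
  obtain ⟨a, ha⟩ := h f.unop
  exact ⟨a, mem_rad_iff_op.mpr ha⟩

theorem ScalarEnd.unop {X : C} (h : ScalarEnd k (Opposite.op X)) : ScalarEnd k X := by
  intro f
  obtain ⟨a, ha⟩ := h f.op
  exact ⟨a, mem_rad_iff_op.mp ha⟩

/-- The class of the identity is non-zero in the quotient, so the quotient is one-dimensional
exactly when this class spans it. This turns a dimension into a condition on morphisms that can be
moved along almost split sequences. -/
theorem trivialAutField_iff {X : C} (hX : IsLocalObj X) : TrivialAutField k X ↔ ScalarEnd k X := by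
  have hne : (Submodule.Quotient.mk (𝟙 X) : (X ⟶ X) ⧸ rad k X X) ≠ 0 := by
    rw [Ne, Submodule.Quotient.mk_eq_zero]
    exact id_notMem_rad hX.id_ne_zero
  unfold TrivialAutField autDim
  constructor
  · intro h f
    obtain ⟨a, ha⟩ := (finrank_eq_one_iff_of_nonzero' _ hne).mp h (Submodule.Quotient.mk f)
    refine ⟨a, ?_⟩
    rw [← Submodule.Quotient.mk_smul, eq_comm, Submodule.Quotient.eq] at ha
    exact ha
  · intro h
    refine (finrank_eq_one_iff_of_nonzero' _ hne).mpr fun x => ?_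
    obtain ⟨f, rfl⟩ := Submodule.Quotient.mk_surjective _ x
    obtain ⟨a, ha⟩ := h f
    exact ⟨a, by rw [← Submodule.Quotient.mk_smul, eq_comm, Submodule.Quotient.eq]; exact ha⟩

/-! ### Irreducible morphisms -/

variable (k) in
/-- The radical morphisms `φ a` span `rad / rad²`. -/
def SpansIrr {X Y : C} {F : Type*} (φ : F → (X ⟶ Y)) : Prop :=
  (∀ a, φ a ∈ rad k X Y) ∧ rad k X Y ≤ radSq k X Y ⊔ Submodule.span k (Set.range φ)

variable (k) in
/-- The morphisms `φ a` are linearly independent modulo `rad²`. -/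
def IndepIrr {X Y : C} {F : Type*} (φ : F → (X ⟶ Y)) : Prop :=
  LinearIndependent k fun a => (radSq k X Y).mkQ (φ a)

theorem SpansIrr.comp_equiv {X Y : C} {F G : Type*} {φ : F → (X ⟶ Y)} (h : SpansIrr k φ)
    (e : G ≃ F) : SpansIrr k (φ ∘ e) := by
  refine ⟨fun a => h.1 _, ?_⟩
  rw [e.surjective.range_comp]
  exact h.2

theorem SpansIrr.op {X Y : C} {F : Type*} {φ : F → (X ⟶ Y)} (h : SpansIrr k φ) :
    SpansIrr k fun a => (φ a).op := by
  refine ⟨fun a => mem_rad_iff_op.mpr (h.1 a), fun f hf => ?_⟩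
  obtain ⟨s, hs, t, ht, e⟩ := Submodule.mem_sup.mp (h.2 (mem_rad_iff_op.mp hf : f.unop ∈ _))
  refine Submodule.mem_sup.mpr ⟨s.op, mem_radSq_iff_op.mpr hs, t.op, ?_, Quiver.Hom.unop_inj e⟩
  have := Submodule.mem_map_of_mem (f := (opLinearEquiv k X Y).toLinearMap) ht
  rw [Submodule.map_span, ← Set.range_comp] at this
  exact this

theorem SpansIrr.unop {X Y : C} {F : Type*} {φ : F → (X ⟶ Y)}
    (h : SpansIrr k fun a => (φ a).op) : SpansIrr k φ := by
  refine ⟨fun a => mem_rad_iff_op.mp (h.1 a), fun f hf => ?_⟩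
  obtain ⟨s, hs, t, ht, e⟩ := Submodule.mem_sup.mp (h.2 (mem_rad_iff_op.mpr hf : f.op ∈ _))
  refine Submodule.mem_sup.mpr ⟨s.unop, mem_radSq_iff_op.mp hs, t.unop, ?_, Quiver.Hom.op_inj e⟩
  have := Submodule.mem_map_of_mem (f := (opLinearEquiv k X Y).symm.toLinearMap) ht
  rw [Submodule.map_span, ← Set.range_comp] at this
  exact this

theorem irrDim_eq_card {X Y : C} {F : Type*} [Fintype F] {φ : F → (X ⟶ Y)}
    (h : SpansIrr k φ) (h' : IndepIrr k φ) : irrDim k X Y = Fintype.card F := by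
  classical
  let p := (radSq k X Y).submoduleOf (rad k X Y)
  let ψ : F → ↥(rad k X Y) ⧸ p := fun a => p.mkQ ⟨φ a, h.1 a⟩
  -- Independence is assumed in Hom/rad², while `irrDim` lives in rad/rad²; this map compares the
  -- two quotients.
  let ι : (↥(rad k X Y) ⧸ p) →ₗ[k] (X ⟶ Y) ⧸ radSq k X Y :=
    Submodule.mapQ p (radSq k X Y) (rad k X Y).subtype le_rfl
  have hli : LinearIndependent k ψ := LinearIndependent.of_comp ι h'
  have hsp : ⊤ ≤ Submodule.span k (Set.range ψ) := by
    rintro x -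
    obtain ⟨⟨f, hf⟩, rfl⟩ := p.mkQ_surjective x
    obtain ⟨s, hs, t, ht, e⟩ := Submodule.mem_sup.mp (h.2 hf)
    have key : ∀ t ∈ Submodule.span k (Set.range φ), ∃ ht : t ∈ rad k X Y,
        p.mkQ ⟨t, ht⟩ ∈ Submodule.span k (Set.range ψ) := by
      intro t ht
      induction ht using Submodule.span_induction with
      | mem x hx => 
        obtain ⟨a, rfl⟩ := hx
        exact ⟨h.1 a, Submodule.subset_span ⟨a, rfl⟩⟩
      | zero => exact ⟨zero_mem _, zero_mem _⟩
      | add x y _ _ hx hy =>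
        obtain ⟨hx, hx'⟩ := hx
        obtain ⟨hy, hy'⟩ := hy
        exact ⟨add_mem hx hy, add_mem hx' hy'⟩
      | smul a x _ hx =>
        obtain ⟨hx, hx'⟩ := hx
        exact ⟨Submodule.smul_mem _ a hx, Submodule.smul_mem _ a hx'⟩
    obtain ⟨ht', ht''⟩ := key t ht
    have : p.mkQ ⟨f, hf⟩ = p.mkQ ⟨t, ht'⟩ := by
      rw [← sub_eq_zero, ← map_sub, Submodule.mkQ_apply, Submodule.Quotient.mk_eq_zero]
      change f - t ∈ radSq k X Y
      rw [← e, add_sub_cancel_right]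
      exact hs
    rw [this]
    exact ht''
  exact Module.finrank_eq_card_basis (Module.Basis.mk hli hsp)

end Radical

/-! ### Source and sink morphisms under duality -/

section SplitOpposite

variable {C : Type u} [Category.{v} C]

theorem isSplitEpi_op_iff {X Y : C} {f : X ⟶ Y} : IsSplitEpi f.op ↔ IsSplitMono f := by
  constructor
  · rintro ⟨⟨s⟩⟩
    exact ⟨⟨s.section_.unop, Quiver.Hom.op_inj s.id⟩⟩
  · rintro ⟨⟨s⟩⟩
    exact ⟨⟨s.retraction.op, Quiver.Hom.unop_inj s.id⟩⟩

theorem isSplitMono_op_iff {X Y : C} {f : X ⟶ Y} : IsSplitMono f.op ↔ IsSplitEpi f := by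
  constructor
  · rintro ⟨⟨s⟩⟩
    exact ⟨⟨s.retraction.unop, Quiver.Hom.op_inj s.id⟩⟩
  · rintro ⟨⟨s⟩⟩
    exact ⟨⟨s.section_.op, Quiver.Hom.unop_inj s.id⟩⟩

theorem IsSourceMorphism.op {X Y : C} {f : X ⟶ Y} (h : IsSourceMorphism f) :
    IsSinkMorphism f.op := by
  refine ⟨⟨fun h' => h.1.1 (isSplitEpi_op_iff.mp h'), fun M g hg => ?_⟩, fun e he => ?_⟩
  · obtain ⟨l, hl⟩ := h.1.2 M.unop g.unop fun h' => hg (isSplitEpi_op_iff.mpr h')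
    exact ⟨l.op, Quiver.Hom.unop_inj hl⟩
  · exact (isIso_unop_iff e).mp (h.2 e.unop (Quiver.Hom.op_inj he))

theorem IsSinkMorphism.op {X Y : C} {f : X ⟶ Y} (h : IsSinkMorphism f) :
    IsSourceMorphism f.op := by
  refine ⟨⟨fun h' => h.1.1 (isSplitMono_op_iff.mp h'), fun M g hg => ?_⟩, fun e he => ?_⟩
  · obtain ⟨l, hl⟩ := h.1.2 M.unop g.unop fun h' => hg (isSplitMono_op_iff.mpr h')
    exact ⟨l.op, Quiver.Hom.unop_inj hl⟩
  · exact (isIso_unop_iff e).mp (h.2 e.unop (Quiver.Hom.op_inj he))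

end SplitOpposite

section AlmostSplit

variable {k : Type w} [Field k] {C : Type u} [Category.{v} C] [Preadditive C] [Linear k C]

/-! ### Almost split sequences and duality -/

theorem IsAlmostSplitSequence.op {X Y Z : C} {f : X ⟶ Y} {g : Y ⟶ Z}
    (h : IsAlmostSplitSequence f g) : IsAlmostSplitSequence g.op f.op := by
  obtain ⟨h₁, h₂, h₃, h₄, h₅⟩ := h
  refine ⟨fun h => h₁ h.unop, h₄.op, ⟨Quiver.Hom.unop_inj h₅.1, fun W l hl => ?_⟩, h₂.op,
    ⟨Quiver.Hom.unop_inj h₃.1, fun W l hl => ?_⟩⟩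
  · obtain ⟨m, hm⟩ := h₅.2 W.unop l.unop (Quiver.Hom.op_inj hl)
    exact ⟨m.op, Quiver.Hom.unop_inj hm⟩
  · obtain ⟨m, hm⟩ := h₃.2 W.unop l.unop (Quiver.Hom.op_inj hl)
    exact ⟨m.op, Quiver.Hom.unop_inj hm⟩

theorem IsAlmostSplitSequence.left_ne_zero {X Y Z : C} {f : X ⟶ Y} {g : Y ⟶ Z}
    (h : IsAlmostSplitSequence f g) : f ≠ 0 := by
  rintro rfl
  have := h.2.1.2 0 zero_comp
  exact h.1 (IsZero.iff_id_eq_zero Y |>.mpr (by rw [← cancel_mono (0 : Y ⟶ Y)]; simp))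

theorem IsAlmostSplitSequence.right_ne_zero {X Y Z : C} {f : X ⟶ Y} {g : Y ⟶ Z}
    (h : IsAlmostSplitSequence f g) : g ≠ 0 := fun h' => h.op.left_ne_zero (by rw [h', op_zero])

theorem IsSourceMorphism.mem_rad {X Y : C} {f : X ⟶ Y} (hf : IsSourceMorphism f)
    (hX : IsLocalObj X) : f ∈ rad k X Y :=
  hX.mem_rad_of_not_isSplitMono hf.1.1

theorem IsSinkMorphism.mem_rad {X Y : C} {f : X ⟶ Y} (hf : IsSinkMorphism f)
    (hY : IsLocalObj Y) : f ∈ rad k X Y :=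
  hY.mem_rad_of_not_isSplitEpi hf.1.1

theorem IsSourceMorphism.exists_comp_eq {X Y M : C} {f : X ⟶ Y} (hf : IsSourceMorphism f)
    (hX : IsLocalObj X) {r : X ⟶ M} (hr : r ∈ rad k X M) : ∃ h : Y ⟶ M, f ≫ h = r :=
  hf.1.2 M r (not_isSplitMono_of_mem_rad hX.id_ne_zero hr)

theorem IsSinkMorphism.exists_comp_eq {X Y M : C} {f : X ⟶ Y} (hf : IsSinkMorphism f)
    (hY : IsLocalObj Y) {r : M ⟶ Y} (hr : r ∈ rad k M Y) : ∃ h : M ⟶ X, h ≫ f = r :=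
  hf.1.2 M r (not_isSplitEpi_of_mem_rad hY.id_ne_zero hr)

/-- In each product of two radical morphisms the first factor goes through `f`, and the second keeps
the remaining factor radical. -/
theorem IsSourceMorphism.exists_comp_eq_of_mem_radSq {X Y N : C} {f : X ⟶ Y}
    (hf : IsSourceMorphism f) (hX : IsLocalObj X) {s : X ⟶ N} (hs : s ∈ radSq k X N) :
    ∃ t ∈ rad k Y N, f ≫ t = s := by
  induction hs using Submodule.span_induction with
  | mem x hx =>
    obtain ⟨Z, p, q, hp, hq, rfl⟩ := hx
    obtain ⟨h, rfl⟩ := hf.exists_comp_eq hX hp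
    exact ⟨h ≫ q, comp_mem_rad _ hq, by simp⟩
  | zero => exact ⟨0, zero_mem _, comp_zero⟩
  | add x y _ _ hx hy =>
    obtain ⟨s, hs, rfl⟩ := hx
    obtain ⟨t, ht, rfl⟩ := hy
    exact ⟨s + t, add_mem hs ht, Preadditive.comp_add _ _ _ _ _ _⟩
  | smul a x _ hx =>
    obtain ⟨s, hs, rfl⟩ := hx
    exact ⟨a • s, Submodule.smul_mem _ a hs, Linear.comp_smul _ _ _ _ _ _⟩

/-- A morphism which composes with a source morphism to an element of the square of the radical
is a radical morphism. -/
theorem IsSourceMorphism.mem_rad_of_comp_mem_radSq {X Y N : C} {f : X ⟶ Y}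
    (hf : IsSourceMorphism f) (hX : IsLocalObj X) (hN : IsLocalObj N) {p : Y ⟶ N}
    (hp : f ≫ p ∈ radSq k X N) : p ∈ rad k Y N := by
  obtain ⟨t, ht, e⟩ := hf.exists_comp_eq_of_mem_radSq hX hp
  by_contra hp'
  have h₁ : p - t ∉ rad k Y N := fun h => hp' (by simpa using add_mem h ht)
  have h₂ : IsSplitEpi (p - t) := by
    by_contra h
    exact h₁ (hN.mem_rad_of_not_isSplitEpi h)
  -- Since `f` kills the split epimorphism `p - t`, the complementary idempotent fixes `f`, so
  -- minimality makes it invertible. But it annihilates `p - t`, which is therefore zero.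
  have := hf.2 (𝟙 Y - (p - t) ≫ section_ (p - t)) (by
    rw [Preadditive.comp_sub, ← Category.assoc f, Preadditive.comp_sub, e]; simp)
  have h₃ : (𝟙 Y - (p - t) ≫ section_ (p - t)) ≫ (p - t) = 0 := by
    rw [Preadditive.sub_comp, Category.assoc, IsSplitEpi.id]; simp
  have h₄ : p - t = 0 := by
    rw [← cancel_epi (𝟙 Y - (p - t) ≫ section_ (p - t)), h₃, comp_zero]
  exact h₁ (h₄ ▸ zero_mem _)

theorem IsLocalObj.isIso_of_isSplitMono {X Y : C} (hX : IsLocalObj X) (hY : IsLocalObj Y)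
    (f : X ⟶ Y) [IsSplitMono f] : IsIso f := by
  rcases hY.isIso_or (retraction f ≫ f) with h | h
  · have : IsSplitEpi f := ⟨⟨inv (retraction f ≫ f) ≫ retraction f, by simp⟩⟩
    exact isIso_of_epi_of_isSplitMono f
  · have h₁ : f ≫ (𝟙 Y - retraction f ≫ f) = 0 := by simp
    have h₂ : f = 0 := by rw [← cancel_mono (𝟙 Y - retraction f ≫ f), h₁, zero_comp]
    exact absurd ((IsSplitMono.id f).symm.trans
      ((congrArg (· ≫ retraction f) h₂).trans zero_comp)) hX.id_ne_zero

/-- Uniqueness of τZ. Lifting `g` through `g'` induces `l : X ⟶ X'`. If `l` is not a section, it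
factors through `f`; subtracting the resulting homotopy term leaves a map `g ≫ n` with `g ≫ (𝟙 Z - n
≫ g') = 0`. Locality of `Z` then forces either a section of `g'` or `g = 0`. -/
theorem IsAlmostSplitSequence.nonempty_iso_left {X Y Z X' Y' : C} {f : X ⟶ Y} {g : Y ⟶ Z}
    {f' : X' ⟶ Y'} {g' : Y' ⟶ Z} (h : IsAlmostSplitSequence f g)
    (h' : IsAlmostSplitSequence f' g') (hX : IsLocalObj X) (hX' : IsLocalObj X')
    (hZ : IsLocalObj Z) : Nonempty (X ≅ X') := by
  obtain ⟨a, ha⟩ := h'.2.2.2.1.1.2 Y g h.2.2.2.1.1.1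
  obtain ⟨l, hl⟩ := h'.2.2.1.2 X (f ≫ a) (by rw [Category.assoc, ha, h.2.2.1.1])
  by_cases hs : IsSplitMono l
  · have := hX.isIso_of_isSplitMono hX' l
    exact ⟨asIso l⟩
  · exfalso
    obtain ⟨m, rfl⟩ := h.2.1.1.2 X' l hs
    obtain ⟨n, hn⟩ := h.2.2.2.2.2 Y' (a - m ≫ f') (by
      rw [Preadditive.comp_sub, ← Category.assoc, hl, sub_self])
    have e : g ≫ (𝟙 Z - n ≫ g') = 0 := by
      rw [Preadditive.comp_sub, ← Category.assoc, hn, Preadditive.sub_comp, ha, Category.assoc,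
        h'.2.2.1.1]
      simp
    rcases hZ.isIso_or (n ≫ g') with hi | hi
    · exact h'.2.2.2.1.1.1 ⟨⟨inv (n ≫ g') ≫ n, by simp⟩⟩
    · exact h.right_ne_zero (by rw [← cancel_mono (𝟙 Z - n ≫ g'), e, zero_comp])

theorem IsAlmostSplitSequence.nonempty_iso_right {X Y Z Y' Z' : C} {f : X ⟶ Y} {g : Y ⟶ Z}
    {f' : X ⟶ Y'} {g' : Y' ⟶ Z'} (h : IsAlmostSplitSequence f g)
    (h' : IsAlmostSplitSequence f' g') (hX : IsLocalObj X) (hZ : IsLocalObj Z)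
    (hZ' : IsLocalObj Z') : Nonempty (Z ≅ Z') := by
  obtain ⟨e⟩ := h'.op.nonempty_iso_left h.op hZ'.op hZ.op hX.op
  exact ⟨e.unop⟩

/-- A radical `c` lifts to `m` along `g`, so `(b, c)` is null-homotopic at `Z` and `b - g ≫ m = l ≫
f`. Then `a - f ≫ l` kills the non-zero `f` and cannot be invertible. -/
theorem IsAlmostSplitSequence.mem_rad_left {X Y Z : C} {f : X ⟶ Y} {g : Y ⟶ Z}
    (h : IsAlmostSplitSequence f g) (hX : IsLocalObj X) (hZ : IsLocalObj Z)
    {a : X ⟶ X} {b : Y ⟶ Y} {c : Z ⟶ Z} (hab : a ≫ f = f ≫ b) (hbc : b ≫ g = g ≫ c)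
    (hc : c ∈ rad k Z Z) : a ∈ rad k X X := by
  obtain ⟨m, rfl⟩ := h.2.2.2.1.exists_comp_eq hZ hc
  obtain ⟨l, hl⟩ := h.2.2.1.2 Y (b - g ≫ m) (by
    rw [Preadditive.sub_comp, hbc, Category.assoc, sub_self])
  have h₁ : (a - f ≫ l) ≫ f = 0 := by
    rw [Preadditive.sub_comp, hab, Category.assoc, hl, Preadditive.comp_sub, ← Category.assoc f g,
      h.2.2.1.1]
    simp
  by_contra ha
  have h₂ : a - f ≫ l ∉ rad k X X := fun h' =>
    ha (by simpa using add_mem h' (mem_rad_comp (h.2.1.mem_rad hX) l))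
  have := hX.isIso_of_notMem_rad hX h₂
  exact h.left_ne_zero (by rw [← cancel_epi (a - f ≫ l), h₁, comp_zero])

/-- An endomorphism of `X` extends to the whole sequence. Subtracting the scalar of the induced
endomorphism of `Z` makes the latter radical, hence also the former by
`IsAlmostSplitSequence.mem_rad_left`. -/
theorem IsAlmostSplitSequence.scalarEnd_left {X Y Z : C} {f : X ⟶ Y} {g : Y ⟶ Z}
    (h : IsAlmostSplitSequence f g) (hX : IsLocalObj X) (hZ : IsLocalObj Z)
    (hs : ScalarEnd k Z) : ScalarEnd k X := by
  intro a
  obtain ⟨b, hb⟩ := h.2.1.exists_comp_eq (k := k) hX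
    (comp_mem_rad a (h.2.1.mem_rad (k := k) hX))
  obtain ⟨c, hc⟩ := h.2.2.2.2.2 Z (b ≫ g) (by
    rw [← Category.assoc, hb, Category.assoc, h.2.2.1.1, comp_zero])
  obtain ⟨t, ht⟩ := hs c
  refine ⟨t, h.mem_rad_left hX hZ (b := b - t • 𝟙 Y) (c := c - t • 𝟙 Z) ?_ ?_ ht⟩
  · simp [hb]
  · simp [hc]

theorem IsAlmostSplitSequence.scalarEnd_right {X Y Z : C} {f : X ⟶ Y} {g : Y ⟶ Z}
    (h : IsAlmostSplitSequence f g) (hX : IsLocalObj X) (hZ : IsLocalObj Z)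
    (hs : ScalarEnd k X) : ScalarEnd k Z :=
  (h.op.scalarEnd_left hZ.op hX.op hs.op).unop

theorem IsAlmostSplitSequence.conj {X Y Z : C} {f : X ⟶ Y} {g : Y ⟶ Z}
    (h : IsAlmostSplitSequence f g) (e : Y ⟶ Y) [IsIso e] :
    IsAlmostSplitSequence (f ≫ e) (inv e ≫ g) := by
  obtain ⟨h₁, ⟨⟨h₂, h₃⟩, h₄⟩, ⟨h₅, h₆⟩, ⟨⟨h₇, h₈⟩, h₉⟩, h₁₀, h₁₁⟩ := h
  refine ⟨h₁, ⟨⟨?_, fun M r hr => ?_⟩, fun a ha => ?_⟩, ⟨by simpa using h₅, fun W r hr => ?_⟩,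
    ⟨⟨?_, fun M r hr => ?_⟩, fun a ha => ?_⟩, by simpa using h₅, fun W r hr => ?_⟩
  · rintro ⟨⟨r⟩⟩
    exact h₂ ⟨⟨e ≫ r.retraction, by rw [← Category.assoc]; exact r.id⟩⟩
  · obtain ⟨l, rfl⟩ := h₃ M r hr
    exact ⟨inv e ≫ l, by simp⟩
  · have := h₄ (e ≫ a ≫ inv e) (by
      rw [← Category.assoc, ← Category.assoc, Category.assoc f, ← Category.assoc f, ha]
      simp)
    have e' : a = inv e ≫ (e ≫ a ≫ inv e) ≫ e := by simp
    rw [e']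
    infer_instance
  · obtain ⟨l, hl⟩ := h₆ W (r ≫ inv e) (by simpa using hr)
    exact ⟨l, by rw [← Category.assoc, hl]; simp⟩
  · rintro ⟨⟨r⟩⟩
    exact h₇ ⟨⟨r.section_ ≫ inv e, by rw [Category.assoc]; exact r.id⟩⟩
  · obtain ⟨l, rfl⟩ := h₈ M r hr
    exact ⟨l ≫ e, by simp⟩
  · have := h₉ (e ≫ a ≫ inv e) (by
      rw [Category.assoc, Category.assoc, ha]
      simp)
    have e' : a = inv e ≫ (e ≫ a ≫ inv e) ≫ e := by simp
    rw [e']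
    infer_instance
  · obtain ⟨l, hl⟩ := h₁₁ W (e ≫ r) (by simpa using hr)
    exact ⟨l, by rw [Category.assoc, hl]; simp⟩

/-! ### Decompositions of objects -/

/-- A decomposition of `Y` as a finite direct sum of the objects `M b`. -/
structure Decomposition (Y : C) {B : Type*} [Fintype B] (M : B → C) where
  ι (b : B) : M b ⟶ Y
  π (b : B) : Y ⟶ M b
  ι_π_self (b : B) : ι b ≫ π b = 𝟙 (M b)
  ι_π_ne {b b' : B} (h : b ≠ b') : ι b ≫ π b' = 0
  sum_π_ι : ∑ b, π b ≫ ι b = 𝟙 Y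

namespace Decomposition

variable {Y : C} {B : Type*} [Fintype B] {M : B → C} (D : Decomposition Y M)

/-- The dual decomposition. -/
def op : Decomposition (Opposite.op Y) fun b => Opposite.op (M b) where
  ι b := (D.π b).op
  π b := (D.ι b).op
  ι_π_self b := Quiver.Hom.unop_inj (D.ι_π_self b)
  ι_π_ne h := Quiver.Hom.unop_inj (D.ι_π_ne h.symm)
  sum_π_ι := by
    refine Quiver.Hom.unop_inj ?_
    rw [unop_sum]
    exact D.sum_π_ι

/-- Change of the index set, and of the summands up to isomorphism. -/
def reindex {B' : Type*} [Fintype B'] {M' : B' → C} (e : B' ≃ B) (θ : ∀ b, M' b ≅ M (e b)) :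
    Decomposition Y M' where
  ι b := (θ b).hom ≫ D.ι (e b)
  π b := D.π (e b) ≫ (θ b).inv
  ι_π_self b := by
    rw [Category.assoc, ← Category.assoc (D.ι _), D.ι_π_self]; simp
  ι_π_ne h := by
    rw [Category.assoc, ← Category.assoc (D.ι _), D.ι_π_ne (e.injective.ne h)]; simp
  sum_π_ι := by
    simp only [Category.assoc, Iso.inv_hom_id_assoc]
    rw [e.sum_comp fun b => D.π b ≫ D.ι b, D.sum_π_ι]

theorem sum_comp_ι {W : C} (f : W ⟶ Y) : ∑ b, (f ≫ D.π b) ≫ D.ι b = f := by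
  simp only [Category.assoc]
  rw [← Preadditive.comp_sum, D.sum_π_ι, Category.comp_id]

theorem sum_π_comp {W : C} (f : Y ⟶ W) : ∑ b, D.π b ≫ D.ι b ≫ f = f := by
  simp only [← Category.assoc]
  rw [← Preadditive.sum_comp, D.sum_π_ι, Category.id_comp]

theorem sum_ι_comp_π {W : C} (f : ∀ b, W ⟶ M b) (b : B) : (∑ b, f b ≫ D.ι b) ≫ D.π b = f b := by
  classical
  rw [Preadditive.sum_comp, Finset.sum_eq_single b]
  · rw [Category.assoc, D.ι_π_self, Category.comp_id]
  · intro b' _ h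
    rw [Category.assoc, D.ι_π_ne h, comp_zero]
  · simp

theorem ι_comp_sum_π {W : C} (f : ∀ b, M b ⟶ W) (b : B) : D.ι b ≫ (∑ b, D.π b ≫ f b) = f b := by
  classical
  rw [Preadditive.comp_sum, Finset.sum_eq_single b]
  · rw [← Category.assoc, D.ι_π_self, Category.id_comp]
  · intro b' _ h
    rw [← Category.assoc, D.ι_π_ne h.symm, zero_comp]
  · simp

end Decomposition

/-! ### Meshes -/

variable (k) in
/-- The families `u b : X ⟶ M b` and `v b : M b ⟶ Z` are the components of an almost split
sequence. -/
structure IsMesh {X Z : C} {B : Type*} [Fintype B] {M : B → C} (u : ∀ b, X ⟶ M b)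
    (v : ∀ b, M b ⟶ Z) : Prop where
  sum_comp : ∑ b, u b ≫ v b = 0
  exists_of_sum_comp_eq_zero {W : C} (w : ∀ b, W ⟶ M b) (h : ∑ b, w b ≫ v b = 0) :
    ∃ l : W ⟶ X, ∀ b, l ≫ u b = w b
  exists_of_comp_sum_eq_zero {W : C} (w : ∀ b, M b ⟶ W) (h : ∑ b, u b ≫ w b = 0) :
    ∃ l : Z ⟶ W, ∀ b, v b ≫ l = w b
  exists_sum_comp_eq {W : C} {r : W ⟶ Z} (hr : r ∈ rad k W Z) :
    ∃ w : ∀ b, W ⟶ M b, ∑ b, w b ≫ v b = r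
  exists_comp_sum_eq {W : C} {r : X ⟶ W} (hr : r ∈ rad k X W) :
    ∃ w : ∀ b, M b ⟶ W, ∑ b, u b ≫ w b = r

theorem IsMesh.unop {X Z : C} {B : Type*} [Fintype B] {M : B → C} {u : ∀ b, X ⟶ M b}
    {v : ∀ b, M b ⟶ Z} (h : IsMesh k (fun b => (v b).op) (fun b => (u b).op)) :
    IsMesh k u v where
  sum_comp := by
    refine Quiver.Hom.op_inj ?_
    rw [op_sum]
    exact h.sum_comp
  exists_of_sum_comp_eq_zero w hw := by
    obtain ⟨l, hl⟩ := h.exists_of_comp_sum_eq_zero (fun b => (w b).op) (by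
      rw [← op_zero, ← hw, op_sum]; rfl)
    exact ⟨l.unop, fun b => Quiver.Hom.op_inj (hl b)⟩
  exists_of_comp_sum_eq_zero w hw := by
    obtain ⟨l, hl⟩ := h.exists_of_sum_comp_eq_zero (fun b => (w b).op) (by
      rw [← op_zero, ← hw, op_sum]; rfl)
    exact ⟨l.unop, fun b => Quiver.Hom.op_inj (hl b)⟩
  exists_sum_comp_eq hr := by
    obtain ⟨w, hw⟩ := h.exists_comp_sum_eq (mem_rad_iff_op.mpr hr)
    exact ⟨fun b => (w b).unop, Quiver.Hom.op_inj (by rw [← hw, op_sum]; rfl)⟩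
  exists_comp_sum_eq hr := by
    obtain ⟨w, hw⟩ := h.exists_sum_comp_eq (mem_rad_iff_op.mpr hr)
    exact ⟨fun b => (w b).unop, Quiver.Hom.op_inj (by rw [← hw, op_sum]; rfl)⟩

theorem IsAlmostSplitSequence.isMesh {X Y Z : C} {f : X ⟶ Y} {g : Y ⟶ Z}
    (h : IsAlmostSplitSequence f g) (hX : IsLocalObj X) (hZ : IsLocalObj Z)
    {B : Type*} [Fintype B] {M : B → C} (D : Decomposition Y M) :
    IsMesh k (fun b => f ≫ D.π b) (fun b => D.ι b ≫ g) where
  sum_comp := by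
    have := congrArg (· ≫ g) (D.sum_comp_ι f)
    simpa [Preadditive.sum_comp, h.2.2.1.1] using this
  exists_of_sum_comp_eq_zero w hw := by
    obtain ⟨l, hl⟩ := h.2.2.1.2 _ (∑ b, w b ≫ D.ι b) (by
      rw [Preadditive.sum_comp]; simpa using hw)
    exact ⟨l, fun b => by rw [← Category.assoc, hl, D.sum_ι_comp_π]⟩
  exists_of_comp_sum_eq_zero w hw := by
    obtain ⟨l, hl⟩ := h.2.2.2.2.2 _ (∑ b, D.π b ≫ w b) (by
      rw [Preadditive.comp_sum]; simpa using hw)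
    exact ⟨l, fun b => by rw [Category.assoc, hl, D.ι_comp_sum_π]⟩
  exists_sum_comp_eq hr := by
    obtain ⟨l, hl⟩ := h.2.2.2.1.exists_comp_eq hZ hr
    refine ⟨fun b => l ≫ D.π b, ?_⟩
    have := congrArg (· ≫ g) (D.sum_comp_ι l)
    simpa [Preadditive.sum_comp, hl] using this
  exists_comp_sum_eq hr := by
    obtain ⟨l, hl⟩ := h.2.1.exists_comp_eq hX hr
    refine ⟨fun b => D.ι b ≫ l, ?_⟩
    have := congrArg (f ≫ ·) (D.sum_π_comp l)
    simpa [Preadditive.comp_sum, hl] using this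

end AlmostSplit

/-! ### Irreducible morphisms and almost split sequences -/

section Irreducible

variable {k : Type w} [Field k] {C : Type u} [Category.{v} C] [Preadditive C] [Linear k C]

theorem indepIrr_iff {X Y : C} {F : Type*} [Fintype F] {φ : F → (X ⟶ Y)} :
    IndepIrr k φ ↔ ∀ c : F → k, ∑ a, c a • φ a ∈ radSq k X Y → ∀ a, c a = 0 := by
  unfold IndepIrr
  rw [Fintype.linearIndependent_iff]
  refine forall_congr' fun c => ?_
  rw [← Submodule.Quotient.mk_eq_zero, ← Submodule.mkQ_apply, map_sum]
  simp only [map_smul]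

variable {V : Type*} {obj : V → C} {F : V → Type*} [Fintype (Σ W, F W)]

/-- A linear relation modulo rad² is a combination of projections that `f` carries into rad²; left
minimality makes this combination radical. Restricting it to one summand leaves a coefficient times
an identity, which is radical only for coefficient zero. -/
theorem IsSourceMorphism.indepIrr {X Y : C} {f : X ⟶ Y} (hf : IsSourceMorphism f)
    (hX : IsLocalObj X) (D : Decomposition Y fun b : Σ W, F W => obj b.1) (W : V)
    (hW : IsLocalObj (obj W)) [Fintype (F W)] :
    IndepIrr k fun a : F W => (f ≫ D.π ⟨W, a⟩ : X ⟶ obj W) := by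
  refine indepIrr_iff.mpr fun c hc a => ?_
  have h₁ : f ≫ (∑ a, c a • D.π ⟨W, a⟩) ∈ radSq k X (obj W) := by
    simpa only [Preadditive.comp_sum, Linear.comp_smul] using hc
  have h₂ := comp_mem_rad (D.ι ⟨W, a⟩) (hf.mem_rad_of_comp_mem_radSq hX hW h₁)
  have h₃ : D.ι ⟨W, a⟩ ≫ (∑ a, c a • D.π ⟨W, a⟩) = c a • 𝟙 (obj W) := by
    classical
    rw [Preadditive.comp_sum, Finset.sum_eq_single a]
    · rw [Linear.comp_smul, D.ι_π_self]
    · intro a' _ ha'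
      rw [Linear.comp_smul, D.ι_π_ne, smul_zero]
      intro e
      exact ha' (by simpa using e.symm)
    · simp
  rw [h₃] at h₂
  exact smul_id_mem_rad hW.id_ne_zero h₂

/-- A radical morphism out of `X` is `f ≫ h`, a sum over the summands of the middle term. A summand
on which `h` is radical contributes to rad². On any other, `h` is an isomorphism, so the summand is
`W` itself and `h` is a scalar modulo the radical. -/
theorem IsSourceMorphism.spansIrr {X Y : C} {f : X ⟶ Y} (hf : IsSourceMorphism f)
    (hX : IsLocalObj X) (D : Decomposition Y fun b : Σ W, F W => obj b.1) (W : V)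
    (hloc : ∀ b : Σ W, F W, IsLocalObj (obj b.1)) (hW : IsLocalObj (obj W))
    (hsc : ScalarEnd k (obj W)) (hinj : ∀ W', Nonempty (obj W' ≅ obj W) → W' = W) :
    SpansIrr k fun a : F W => (f ≫ D.π ⟨W, a⟩ : X ⟶ obj W) := by
  have hfrad : f ∈ rad k X Y := hf.mem_rad hX
  refine ⟨fun a => mem_rad_comp hfrad _, fun r hr => ?_⟩
  obtain ⟨h, rfl⟩ := hf.exists_comp_eq hX hr
  rw [← D.sum_π_comp h, Preadditive.comp_sum]
  refine Submodule.sum_mem _ fun b _ => ?_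
  by_cases hb : D.ι b ≫ h ∈ rad k (obj b.1) (obj W)
  · rw [← Category.assoc]
    exact Submodule.mem_sup_left (comp_mem_radSq (mem_rad_comp hfrad _) hb)
  · have := (hloc b).isIso_of_notMem_rad hW hb
    obtain ⟨W', a⟩ := b
    obtain rfl : W' = W := hinj W' ⟨asIso (D.ι ⟨W', a⟩ ≫ h)⟩
    obtain ⟨c, hc⟩ := hsc (D.ι ⟨W', a⟩ ≫ h)
    have e : f ≫ D.π ⟨W', a⟩ ≫ D.ι ⟨W', a⟩ ≫ h
        = (f ≫ D.π ⟨W', a⟩) ≫ (D.ι ⟨W', a⟩ ≫ h - c • 𝟙 (obj W')) + c • (f ≫ D.π ⟨W', a⟩) := by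
      simp [Preadditive.comp_sub]
    rw [e]
    exact Submodule.add_mem_sup (comp_mem_radSq (mem_rad_comp hfrad _) hc)
      (Submodule.smul_mem _ _ (Submodule.subset_span ⟨a, rfl⟩))

theorem IsSinkMorphism.indepIrr {Y Z : C} {g : Y ⟶ Z} (hg : IsSinkMorphism g)
    (hZ : IsLocalObj Z) (D : Decomposition Y fun b : Σ W, F W => obj b.1) (W : V)
    (hW : IsLocalObj (obj W)) [Fintype (F W)] :
    IndepIrr k fun a : F W => (D.ι ⟨W, a⟩ ≫ g : obj W ⟶ Z) := by
  have h := hg.op.indepIrr (k := k) (obj := fun W => Opposite.op (obj W)) hZ.op D.op W hW.op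
  refine indepIrr_iff.mpr fun c hc => indepIrr_iff.mp h c ?_
  rw [← mem_radSq_iff_op, op_sum] at hc
  exact hc

theorem IsSinkMorphism.spansIrr {Y Z : C} {g : Y ⟶ Z} (hg : IsSinkMorphism g)
    (hZ : IsLocalObj Z) (D : Decomposition Y fun b : Σ W, F W => obj b.1) (W : V)
    (hloc : ∀ b : Σ W, F W, IsLocalObj (obj b.1)) (hW : IsLocalObj (obj W))
    (hsc : ScalarEnd k (obj W)) (hinj : ∀ W', Nonempty (obj W' ≅ obj W) → W' = W) :
    SpansIrr k fun a : F W => (D.ι ⟨W, a⟩ ≫ g : obj W ⟶ Z) :=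
  (hg.op.spansIrr (k := k) (obj := fun W => Opposite.op (obj W)) hZ.op D.op W
    (fun b => (hloc b).op) hW.op hsc.op fun W' ⟨e⟩ => hinj W' ⟨e.unop.symm⟩).unop

/-- A finite dimensional algebra is Artinian, so one-sided inverses are two-sided. -/
theorem isIso_of_comp_eq_id [hfin : ∀ Y : C, Module.Finite k (Y ⟶ Y)] {Y : C} {a b : Y ⟶ Y}
    (h : a ≫ b = 𝟙 Y) : IsIso a := by
  have : Module.Finite k (End Y) := hfin Y
  have : IsArtinianRing (End Y) := IsArtinianRing.of_finite k (End Y)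
  have h' : @HMul.hMul (End Y) (End Y) (End Y) _ a b = 1 :=
    mul_eq_one_symm (M := End Y) (a := b) (b := a) h
  exact ⟨b, h, h'⟩

/-- Any family of morphisms spanning the irreducible morphisms starting in `X` is obtained from
a source morphism by a change of coordinates. -/
theorem IsSourceMorphism.exists_isIso {X Y : C} {f : X ⟶ Y} (hf : IsSourceMorphism f)
    (hfin : HomFinite k C)
    (hX : IsLocalObj X) (D : Decomposition Y fun b : Σ W, F W => obj b.1)
    (φ : ∀ W, F W → (X ⟶ obj W)) (hφ : ∀ b : Σ W, F W, SpansIrr k (φ b.1)) :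
    ∃ h : Y ⟶ Y, IsIso h ∧ ∀ b, (f ≫ h) ≫ D.π b = φ b.1 b.2 := by
  let u : X ⟶ Y := ∑ b, φ b.1 b.2 ≫ D.ι b
  have hu : ∀ b, u ≫ D.π b = φ b.1 b.2 := fun b =>
    D.sum_ι_comp_π (fun b : Σ W, F W => φ b.1 b.2) b
  have hurad : u ∈ rad k X Y := Submodule.sum_mem _ fun b _ => mem_rad_comp ((hφ b).1 _) _
  obtain ⟨h, hh⟩ := hf.exists_comp_eq hX hurad
  have hspan : ∀ W, ∀ s ∈ Submodule.span k (Set.range (φ W)), ∃ c : Y ⟶ obj W, u ≫ c = s := by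
    intro W s hs
    induction hs using Submodule.span_induction with
    | mem x hx =>
      obtain ⟨a, rfl⟩ := hx
      exact ⟨D.π ⟨W, a⟩, hu ⟨W, a⟩⟩
    | zero => exact ⟨0, comp_zero⟩
    | add x y _ _ hx hy =>
      obtain ⟨s, rfl⟩ := hx
      obtain ⟨t, rfl⟩ := hy
      exact ⟨s + t, Preadditive.comp_add _ _ _ _ _ _⟩
    | smul a x _ hx =>
      obtain ⟨s, rfl⟩ := hx
      exact ⟨a • s, Linear.comp_smul _ _ _ _ _ _⟩
  -- Modulo rad² each component of `f` is a combination of the `φ`, hence factors through `u`. The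
  -- rad² part is `f` followed by a radical morphism.
  have hcomp : ∀ b : Σ W, F W, ∃ (c t : Y ⟶ obj b.1), t ∈ rad k Y (obj b.1) ∧
      f ≫ D.π b = u ≫ c + f ≫ t := by
    intro b
    obtain ⟨s, hs, t, ht, e⟩ :=
      Submodule.mem_sup.mp ((hφ b).2 (mem_rad_comp (hf.mem_rad hX) (D.π b)))
    obtain ⟨s', hs', rfl⟩ := hf.exists_comp_eq_of_mem_radSq hX hs
    obtain ⟨c, rfl⟩ := hspan _ t ht
    exact ⟨c, s', hs', by rw [← e, add_comm]⟩
  choose c t ht hct using hcomp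
  let c' : Y ⟶ Y := ∑ b, c b ≫ D.ι b
  let t' : Y ⟶ Y := ∑ b, t b ≫ D.ι b
  have ht' : t' ∈ rad k Y Y := Submodule.sum_mem _ fun b _ => mem_rad_comp (ht b) _
  have e₁ : f = u ≫ c' + f ≫ t' := by
    conv_lhs => rw [← D.sum_comp_ι f]
    simp only [hct, Preadditive.add_comp, Finset.sum_add_distrib, Category.assoc, c', t',
      Preadditive.comp_sum]
  have hi : IsIso (𝟙 Y - t') := by simpa using ht' (𝟙 Y)
  -- From `f ≫ (𝟙 Y - t') = u ≫ c'` and `u = f ≫ h`. Minimality of `f` now makes the bracket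
  -- invertible, so `h` has a right inverse, which suffices by finite dimensionality.
  have e₂ : f ≫ (h ≫ c' ≫ inv (𝟙 Y - t')) = f := by
    rw [← cancel_mono (𝟙 Y - t')]
    simp only [Category.assoc, IsIso.inv_hom_id, Category.comp_id]
    rw [← Category.assoc, hh, Preadditive.comp_sub, Category.comp_id]
    exact eq_sub_of_add_eq e₁.symm
  have := hf.2 _ e₂
  refine ⟨h, isIso_of_comp_eq_id (k := k) (hfin := fun Y => hfin Y Y)
    (b := (c' ≫ inv (𝟙 Y - t')) ≫ inv (h ≫ c' ≫ inv (𝟙 Y - t'))) ?_, fun b => by rw [hh, hu]⟩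
  rw [← Category.assoc, IsIso.hom_inv_id]

/-- A family spanning the irreducible morphisms starting in `X` can be completed to a mesh. -/
theorem IsAlmostSplitSequence.exists_isMesh_right {X Y Z : C} {f : X ⟶ Y} {g : Y ⟶ Z}
    (h : IsAlmostSplitSequence f g) (hfin : HomFinite k C) (hX : IsLocalObj X)
    (hZ : IsLocalObj Z) (hloc : ∀ W, IsLocalObj (obj W)) (hsc : ∀ W, ScalarEnd k (obj W))
    (hinj : ∀ W W', Nonempty (obj W ≅ obj W') → W = W')
    (D : Decomposition Y fun b : Σ W, F W => obj b.1)
    (φ : ∀ W, F W → (X ⟶ obj W)) (hφ : ∀ b : Σ W, F W, SpansIrr k (φ b.1)) :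
    ∃ ψ : ∀ W, F W → (obj W ⟶ Z), (∀ W, SpansIrr k (ψ W)) ∧
      IsMesh k (fun b : Σ W, F W => φ b.1 b.2) (fun b => ψ b.1 b.2) := by
  obtain ⟨e, he, hφe⟩ := h.2.1.exists_isIso hfin hX D φ hφ
  refine ⟨fun W a => D.ι ⟨W, a⟩ ≫ inv e ≫ g, fun W => IsSinkMorphism.spansIrr (h.conj e).2.2.2.1 hZ D W
    (fun b => hloc b.1) (hloc W) (hsc W) fun W' => hinj W' W, ?_⟩
  have := (h.conj e).isMesh (k := k) hX hZ D
  simp only [hφe] at this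
  exact this

/-- A family spanning the irreducible morphisms ending in `Z` can be completed to a mesh. -/
theorem IsAlmostSplitSequence.exists_isMesh_left {X Y Z : C} {f : X ⟶ Y} {g : Y ⟶ Z}
    (h : IsAlmostSplitSequence f g) (hfin : HomFinite k C) (hX : IsLocalObj X)
    (hZ : IsLocalObj Z) (hloc : ∀ W, IsLocalObj (obj W)) (hsc : ∀ W, ScalarEnd k (obj W))
    (hinj : ∀ W W', Nonempty (obj W ≅ obj W') → W = W')
    (D : Decomposition Y fun b : Σ W, F W => obj b.1)
    (ψ : ∀ W, F W → (obj W ⟶ Z)) (hψ : ∀ b : Σ W, F W, SpansIrr k (ψ b.1)) :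
    ∃ φ : ∀ W, F W → (X ⟶ obj W), (∀ W, SpansIrr k (φ W)) ∧
      IsMesh k (fun b : Σ W, F W => φ b.1 b.2) (fun b => ψ b.1 b.2) := by
  have hfin' : HomFinite k Cᵒᵖ := fun A B => by
    have := hfin B.unop A.unop
    exact Module.Finite.equiv (opLinearEquiv k B.unop A.unop)
  obtain ⟨φ, hφ, hm⟩ := h.op.exists_isMesh_right (k := k) (obj := fun W => Opposite.op (obj W))
    hfin' hZ.op hX.op (fun W => (hloc W).op) (fun W => (hsc W).op)
    (fun W W' ⟨e⟩ => hinj W W' ⟨e.unop.symm⟩) D.op (fun W a => (ψ W a).op)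
    (fun b => (hψ b).op)
  exact ⟨fun W a => (φ W a).unop, fun W => (hφ W).unop, hm.unop⟩

end Irreducible

/-! ### Indecomposable objects of a Krull-Schmidt category -/

section KrullSchmidt

variable {C : Type u} [Category.{v} C] [Preadditive C] [HasFiniteBiproducts C]

/-- A finite biproduct, as a decomposition. -/
noncomputable def Decomposition.ofIsoBiproduct {X : C} {B : Type} [Fintype B] {M : B → C}
    (e : X ≅ ⨁ M) : Decomposition X M where
  ι b := biproduct.ι M b ≫ e.inv
  π b := e.hom ≫ biproduct.π M b
  ι_π_self b := by simp
  ι_π_ne h := by simp [biproduct.ι_π_ne _ h]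
  sum_π_ι := by
    have : ∑ b, (e.hom ≫ biproduct.π M b) ≫ biproduct.ι M b ≫ e.inv
        = e.hom ≫ (∑ b, biproduct.π M b ≫ biproduct.ι M b) ≫ e.inv := by
      simp only [Preadditive.comp_sum, Preadditive.sum_comp, Category.assoc]
    rw [this, biproduct.total]
    simp

theorem exists_iso_summand {X : C} (hX : IsIndec X) {B : Type} [Fintype B] {M : B → C}
    (D : Decomposition X M) (hM : ∀ b, IsLocalObj (M b)) : ∃ b, Nonempty (X ≅ M b) := by
  classical
  have := hasBinaryBiproducts_of_finite_biproducts C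
  have hX' : Indecomposable X := hX
  have hne : Nonempty B := by
    by_contra h
    rw [not_nonempty_iff] at h
    refine hX'.1 ((IsZero.iff_id_eq_zero X).mpr ?_)
    rw [← D.sum_π_ι, Fintype.sum_empty]
  -- Any index will do: all `M i` are non-zero, so indecomposability kills the complement of
  -- whichever summand is chosen.
  obtain ⟨i⟩ := hne
  let K : C := ⨁ fun j : {j // j ≠ i} => M j
  let p : X ⟶ K := biproduct.lift fun j : {j // j ≠ i} => D.π j
  let q : K ⟶ X := biproduct.desc fun j : {j // j ≠ i} => D.ι j
  have hqp : q ≫ p = 𝟙 (⨁ fun j : {j // j ≠ i} => M j) := by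
    refine biproduct.hom_ext' _ _ fun j => biproduct.hom_ext _ _ fun j' => ?_
    simp only [p, q, Category.assoc, biproduct.ι_desc_assoc, biproduct.lift_π, Category.id_comp]
    by_cases h : j = j'
    · subst h
      rw [D.ι_π_self, biproduct.ι_π_self]
    · rw [D.ι_π_ne fun h' => h (Subtype.ext h'), biproduct.ι_π_ne _ h]
  have hqi : q ≫ D.π i = 0 := by
    refine biproduct.hom_ext' _ _ fun j => ?_
    simp only [q, biproduct.ι_desc_assoc, comp_zero]
    exact D.ι_π_ne j.2
  have hip : D.ι i ≫ p = 0 := by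
    refine biproduct.hom_ext _ _ fun j => ?_
    simp only [p, Category.assoc, biproduct.lift_π, zero_comp]
    exact D.ι_π_ne j.2.symm
  have hsum : D.π i ≫ D.ι i + p ≫ q = 𝟙 X := by
    have : p ≫ q = ∑ j : {j // j ≠ i}, D.π j ≫ D.ι j := biproduct.lift_desc
    rw [this, ← D.sum_π_ι, ← Finset.add_sum_erase _ _ (Finset.mem_univ i)]
    congr 1
    exact (Finset.sum_subtype (Finset.univ.erase i) (fun j => by simp)
      fun j => D.π j ≫ D.ι j).symm
  have e : X ≅ M i ⊞ K :=
    { hom := biprod.lift (D.π i) p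
      inv := biprod.desc (D.ι i) q
      hom_inv_id := by rw [biprod.lift_desc, hsum]
      inv_hom_id := by
        refine biprod.hom_ext' _ _ (biprod.hom_ext _ _ ?_ ?_) (biprod.hom_ext _ _ ?_ ?_)
        · simp [D.ι_π_self]
        · simp [hip]
        · simp [hqi]
        · simp only [biprod.inr_desc_assoc, biprod.lift_snd, Category.assoc, biprod.inr_snd,
            Category.comp_id, hqp]
          rfl }
  rcases hX'.2 _ _ e with h | h
  · exact absurd ((IsZero.iff_id_eq_zero _).mp h) (hM i).id_ne_zero
  · refine ⟨i, ⟨⟨D.π i, D.ι i, ?_, D.ι_π_self i⟩⟩⟩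
    rw [← hsum, h.eq_of_tgt p 0]
    simp

theorem isLocalObj_of_isIndec (hKS : KrullSchmidt C) {X : C} (hX : IsIndec X) : IsLocalObj X := by
  have := hasBinaryBiproducts_of_finite_biproducts C
  have hX' : Indecomposable X := hX
  obtain ⟨n, Y, hY, ⟨e⟩⟩ := hKS X hX'.1
  obtain ⟨b, ⟨e'⟩⟩ := exists_iso_summand hX (Decomposition.ofIsoBiproduct e)
    fun b => IsLocalObj.of_isLocalRing (hY b)
  exact (IsLocalObj.of_isLocalRing (hY b)).of_iso e'.symm

/-- The idempotents of a decomposition into two summands add up to the identity, so one of them is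
invertible and the other summand is zero. -/
theorem IsLocalObj.isIndec {X : C} (hX : IsLocalObj X) : IsIndec X := by
  have := hasBinaryBiproducts_of_finite_biproducts C
  refine ⟨fun h => hX.id_ne_zero ((IsZero.iff_id_eq_zero X).mp h), fun Y Z e => ?_⟩
  have key : ∀ (A B : C) (i : A ⟶ X) (p : X ⟶ A) (j : B ⟶ X) (q : X ⟶ B), i ≫ p = 𝟙 A →
      i ≫ q = 0 → IsIso (q ≫ j) → IsZero A := by
    intro A B i p j q hip hiq hqj
    have : i = 0 := by
      rw [← cancel_mono (q ≫ j), ← Category.assoc, hiq]; simp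
    rw [IsZero.iff_id_eq_zero, ← hip, this, zero_comp]
  have htot : 𝟙 X - (e.hom ≫ biprod.fst) ≫ (biprod.inl ≫ e.inv)
      = (e.hom ≫ biprod.snd) ≫ (biprod.inr ≫ e.inv) := by
    have : e.hom ≫ (biprod.fst ≫ biprod.inl + biprod.snd ≫ biprod.inr) ≫ e.inv = 𝟙 X := by
      rw [biprod.total]; simp
    rw [sub_eq_iff_eq_add', ← this]
    simp only [Preadditive.add_comp, Preadditive.comp_add, Category.assoc]
  rcases hX.isIso_or ((e.hom ≫ biprod.fst) ≫ (biprod.inl ≫ e.inv)) with h | h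
  · right
    exact key Z Y (biprod.inr ≫ e.inv) (e.hom ≫ biprod.snd) (biprod.inl ≫ e.inv)
      (e.hom ≫ biprod.fst) (by simp) (by simp) h
  · left
    rw [htot] at h
    exact key Y Z (biprod.inl ≫ e.inv) (e.hom ≫ biprod.fst) (biprod.inr ≫ e.inv)
      (e.hom ≫ biprod.snd) (by simp) (by simp) h

theorem exists_decomposition (hKS : KrullSchmidt C) {ind : Set C} (hind : IsVertexSet ind) {Y : C}
    (hY : ¬ IsZero Y) : ∃ (n : ℕ) (N : Fin n → C), (∀ j, N j ∈ ind) ∧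
      Nonempty (Decomposition Y N) := by
  obtain ⟨n, M, hM, ⟨e⟩⟩ := hKS Y hY
  have h : ∀ j, ∃ N ∈ ind, Nonempty (M j ≅ N) := fun j => by
    obtain ⟨N, hN, -⟩ := hind.2 (M j) (IsLocalObj.of_isLocalRing (hM j)).isIndec
    exact ⟨N, hN⟩
  choose N hN hi using h
  exact ⟨n, N, hN, ⟨(Decomposition.ofIsoBiproduct e).reindex (Equiv.refl _)
    fun j => (hi j).some.symm⟩⟩

end KrullSchmidt

/-! ### Components of the Auslander-Reiten quiver -/

section Component

variable {k : Type w} [Field k] {C : Type u} [Category.{v} C] [Preadditive C] [Linear k C]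

theorem irrDim_pos (hfin : HomFinite k C) {X Y : C} {f : X ⟶ Y} (hf : f ∈ rad k X Y)
    (hf' : f ∉ radSq k X Y) : 0 < irrDim k X Y := by
  have := hfin X Y
  refine Module.finrank_pos_iff_exists_ne_zero.mpr ⟨Submodule.Quotient.mk ⟨f, hf⟩, ?_⟩
  rw [Ne, Submodule.Quotient.mk_eq_zero]
  exact hf'

/-- Meant for a `Y` not yet known to belong to the component, whose automorphism field is not under
control. Either the valuation is symmetric and equals `irrDim k X Y`, or there is a single valued
arrow. -/
theorem numArrows_pos_of_left {X Y : C} (hX : TrivialAutField k X) (h : 0 < irrDim k X Y) :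
    0 < numArrows k X Y := by
  unfold numArrows
  split_ifs with h'
  · rw [h', valLeft, hX, Nat.div_one]
    exact h
  · exact one_pos

theorem numArrows_eq_irrDim {X Y : C} (hX : TrivialAutField k X) (hY : TrivialAutField k Y) :
    numArrows k X Y = irrDim k X Y := by
  have hX' : autDim k X = 1 := hX
  have hY' : autDim k Y = 1 := hY
  simp [numArrows, valLeft, valRight, hX', hY']

theorem IsComponent.mem_of_arrowIn {ind Γ : Set C} (hΓ : IsComponent k ind Γ) {X Y : C}
    (hX : X ∈ Γ) (h : ArrowIn k ind X Y) : Y ∈ Γ := by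
  obtain ⟨A, -, rfl⟩ := hΓ
  exact Relation.EqvGen.trans _ _ _ hX (Relation.EqvGen.rel _ _ h)

theorem IsComponent.subset {ind Γ : Set C} (hΓ : IsComponent k ind Γ) : Γ ⊆ ind := by
  obtain ⟨A, hA, rfl⟩ := hΓ
  intro Y hY
  have key : ∀ A Y, Relation.EqvGen (ArrowIn k ind) A Y → (A ∈ ind ↔ Y ∈ ind) := by
    intro A Y h
    induction h with
    | rel x y h => exact ⟨fun _ => h.2.1, fun _ => h.1⟩
    | refl x => exact Iff.rfl
    | symm x y _ ih => exact ih.symm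
    | trans x y z _ _ ih ih' => exact ih.trans ih'
  exact (key A Y hY).mp hA

variable [HasFiniteBiproducts C]

theorem IsVertexSet.eq_of_iso {ind : Set C} (hind : IsVertexSet ind) {X Y : C} (hX : X ∈ ind)
    (hY : Y ∈ ind) (e : X ≅ Y) : X = Y :=
  (hind.2 X (hind.1 X hX)).unique ⟨hX, ⟨Iso.refl X⟩⟩ ⟨hY, ⟨e⟩⟩

variable (k) in
/-- The middle term of an almost split sequence in a component with trivial automorphism fields
is the direct sum of the sources of the arrows ending in `Z`, equivalently, of the targets of the
arrows starting in `X`. -/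
structure MeshDecomposition (Γ : Set C) (X Z : Vertex k Γ) {Y : C} (f : X.obj ⟶ Y)
    (g : Y ⟶ Z.obj) : Prop where
  finite : Finite (Σ W : Vertex k Γ, (X ⟶ W))
  nonempty : Nonempty (Σ W : Vertex k Γ, (X ⟶ W))
  decomposition [Fintype (Σ W : Vertex k Γ, (X ⟶ W))] :
    Nonempty (Decomposition Y fun b : Σ W : Vertex k Γ, (X ⟶ W) => b.1.obj)
  numArrows_eq (W : Vertex k Γ) : numArrows k W.obj Z.obj = numArrows k X.obj W.obj

/-- The multiplicity of `W` in the middle term is the dimension of irr(X, W), by the source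
morphism, and also that of irr(W, Z), by the sink morphism. With trivial automorphism fields these
dimensions are numbers of arrows. -/
theorem IsAlmostSplitSequence.meshDecomposition (hfin : HomFinite k C) (hKS : KrullSchmidt C)
    {ind Γ : Set C} (hind : IsVertexSet ind) (hΓ : IsComponent k ind Γ)
    (htriv : ∀ X ∈ Γ, TrivialAutField k X) {X Z : Vertex k Γ} {Y : C} {f : X.obj ⟶ Y}
    {g : Y ⟶ Z.obj} (h : IsAlmostSplitSequence f g) : MeshDecomposition k Γ X Z f g := by
  classical
  have hlocind : ∀ X ∈ ind, IsLocalObj X := fun X hX => isLocalObj_of_isIndec hKS (hind.1 X hX)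
  have hloc : ∀ W : Vertex k Γ, IsLocalObj W.obj := fun W => hlocind _ (hΓ.subset W.mem)
  have hsc : ∀ W : Vertex k Γ, ScalarEnd k W.obj := fun W =>
    (trivialAutField_iff (hloc W)).mp (htriv _ W.mem)
  have hinj : ∀ W W' : Vertex k Γ, Nonempty (W.obj ≅ W'.obj) → W = W' := fun W W' ⟨e⟩ =>
    Vertex.ext (hind.eq_of_iso (hΓ.subset W.mem) (hΓ.subset W'.mem) e)
  obtain ⟨n, N, hN, ⟨D⟩⟩ := exists_decomposition hKS hind h.1
  -- A component of `f` in rad² would make its projection radical, and with it the identity of the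
  -- summand. So every component is irreducible, and gives an arrow from `X` that stays in Γ.
  have hNΓ : ∀ j, N j ∈ Γ := by
    intro j
    refine hΓ.mem_of_arrowIn X.mem ⟨hΓ.subset X.mem, hN j, numArrows_pos_of_left (htriv _ X.mem)
      (irrDim_pos hfin (mem_rad_comp (h.2.1.mem_rad (hloc X)) (D.π j)) fun h' => ?_)⟩
    have := comp_mem_rad (D.ι j) (h.2.1.mem_rad_of_comp_mem_radSq (hloc X) (hlocind _ (hN j)) h')
    rw [D.ι_π_self] at this
    exact id_notMem_rad (hlocind _ (hN j)).id_ne_zero this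
  let V := Vertex k Γ
  let m : Fin n → V := fun j => ⟨N j, hNΓ j⟩
  let F : V → Type := fun W => {j // m j = W}
  let E : (Σ W, F W) ≃ Fin n := Equiv.sigmaFiberEquiv m
  have : Fintype (Σ W, F W) := Fintype.ofEquiv _ E.symm
  let D' : Decomposition Y fun b : Σ W, F W => b.1.obj :=
    D.reindex E fun b => eqToIso (congrArg Vertex.obj b.2.2.symm)
  have c₁ : ∀ W : V, irrDim k X.obj W.obj = Fintype.card (F W) := fun W =>
    irrDim_eq_card (h.2.1.spansIrr (hloc X) D' W (fun b => hloc b.1) (hloc W) (hsc W)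
      fun W' => hinj W' W) (h.2.1.indepIrr (hloc X) D' W (hloc W))
  have c₂ : ∀ W : V, irrDim k W.obj Z.obj = Fintype.card (F W) := fun W =>
    irrDim_eq_card (h.2.2.2.1.spansIrr (hloc Z) D' W (fun b => hloc b.1) (hloc W) (hsc W)
      fun W' => hinj W' W) (h.2.2.2.1.indepIrr (hloc Z) D' W (hloc W))
  have c₁' : ∀ W : V, numArrows k X.obj W.obj = Fintype.card (F W) := fun W => by
    rw [numArrows_eq_irrDim (htriv _ X.mem) (htriv _ W.mem), c₁]
  have c₂' : ∀ W : V, numArrows k W.obj Z.obj = Fintype.card (F W) := fun W => by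
    rw [numArrows_eq_irrDim (htriv _ W.mem) (htriv _ Z.mem), c₂]
  let e : ∀ W : V, (X ⟶ W) ≃ F W := fun W => (finCongr (c₁' W)).trans (Fintype.equivFin _).symm
  let e' : (Σ W : V, (X ⟶ W)) ≃ Σ W, F W := Equiv.sigmaCongrRight e
  refine ⟨Finite.of_equiv _ e'.symm, ?_, ⟨D'.reindex e' fun b => Iso.refl _⟩,
    fun W => (c₂' W).trans (c₁' W).symm⟩
  by_contra hemp
  rw [not_nonempty_iff] at hemp
  have := e'.symm.isEmpty
  refine h.1 ((IsZero.iff_id_eq_zero Y).mpr ?_)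
  rw [← D'.sum_π_ι, Fintype.sum_empty]

end Component

/-! ### Evaluation of path categories -/

section PathCategory

universe v₁ u₁

variable (k : Type w) [Field k] {V : Type u₁} [Quiver.{v₁} V]

/-- A vertex, as an object of the path category. -/
abbrev pathOb (X : V) : PathCat k V := Free.of k ((Paths.of V).obj X)

/-- A path, as a morphism of the path category. -/
noncomputable def pathHom {X Y : V} (p : Quiver.Path X Y) : pathOb k X ⟶ pathOb k Y :=
  (Free.embedding k (Paths V)).map p

theorem pathHom_nil (X : V) : pathHom k (Quiver.Path.nil : Quiver.Path X X) = 𝟙 (pathOb k X) := rfl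

theorem pathHom_comp {X Y Z : V} (p : Quiver.Path X Y) (q : Quiver.Path Y Z) :
    pathHom k (p.comp q) = pathHom k p ≫ pathHom k q :=
  (Free.embedding k (Paths V)).map_comp (X := X) (Y := Y) (Z := Z) p q

theorem pathHom_toPath {X Y : V} (a : X ⟶ Y) : pathHom k a.toPath = arrowMap k a := rfl

theorem pathHom_cons {X Y Z : V} (p : Quiver.Path X Y) (a : Y ⟶ Z) :
    pathHom k (p.cons a) = pathHom k p ≫ arrowMap k a :=
  pathHom_comp k p a.toPath

variable {k}

theorem pathHom_induction {X Y : V} {P : (pathOb k X ⟶ pathOb k Y) → Prop}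
    (zero : P 0) (add : ∀ f g, P f → P g → P (f + g)) (smul : ∀ (a : k) f, P f → P (a • f))
    (path : ∀ p : Quiver.Path X Y, P (pathHom k p)) (f : pathOb k X ⟶ pathOb k Y) : P f := by
  have key : ∀ g : Quiver.Path X Y →₀ k, P g := fun g =>
    Finsupp.induction_linear (motive := P) g zero add fun p a =>
      (show a • pathHom k p = (Finsupp.single p a : Quiver.Path X Y →₀ k) from
        Finsupp.smul_single_one p a) ▸ smul a _ (path p)
  exact key f

theorem hom_eq_zero_of_isEmpty {X Y : V} (h : IsEmpty (Quiver.Path X Y))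
    (f : pathOb k X ⟶ pathOb k Y) : f = 0 :=
  pathHom_induction (P := fun f => f = 0) rfl (by rintro _ _ rfl rfl; exact add_zero 0)
    (by rintro a _ rfl; exact smul_zero a) (fun p => h.elim p) f

variable {C : Type u} [Category.{v} C] {obj : V → C}
  (φ : ∀ ⦃X Y : V⦄, (X ⟶ Y) → (obj X ⟶ obj Y))

/-- The composition of the images of the arrows of a path. -/
def evalPath {X : V} : ∀ {Y : V}, Quiver.Path X Y → (obj X ⟶ obj Y)
  | _, .nil => 𝟙 (obj X)
  | _, .cons p a => evalPath p ≫ φ a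

theorem evalPath_comp {X Y Z : V} (p : Quiver.Path X Y) (q : Quiver.Path Y Z) :
    evalPath φ (p.comp q) = evalPath φ p ≫ evalPath φ q := by
  induction q with
  | nil => simp [evalPath]
  | cons q a ih => simp [evalPath, ih]

variable [Preadditive C] [Linear k C]

variable (k) in
/-- The linear extension of `evalPath`. -/
noncomputable def evalHom (X Y : V) : (pathOb k X ⟶ pathOb k Y) →ₗ[k] (obj X ⟶ obj Y) :=
  Finsupp.linearCombination k (evalPath φ (X := X) (Y := Y))

@[simp]
theorem evalHom_pathHom {X Y : V} (p : Quiver.Path X Y) :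
    evalHom k φ X Y (pathHom k p) = evalPath φ p := by
  refine (Finsupp.linearCombination_single k 1 p).trans (one_smul k _)

@[simp]
theorem evalHom_id (X : V) : evalHom k φ X X (𝟙 (pathOb k X)) = 𝟙 (obj X) := by
  rw [← pathHom_nil, evalHom_pathHom]; rfl

@[simp]
theorem evalHom_arrowMap {X Y : V} (a : X ⟶ Y) : evalHom k φ X Y (arrowMap k a) = φ a := by
  rw [← pathHom_toPath, evalHom_pathHom]
  exact Category.id_comp _

@[simp]
theorem evalHom_comp {X Y Z : V} (f : pathOb k X ⟶ pathOb k Y) (g : pathOb k Y ⟶ pathOb k Z) :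
    evalHom k φ X Z (f ≫ g) = evalHom k φ X Y f ≫ evalHom k φ Y Z g := by
  induction f using pathHom_induction with
  | zero => simp
  | add f f' hf hf' => simp [Preadditive.add_comp, hf, hf']
  | smul a f hf => simp [hf]
  | path p =>
    induction g using pathHom_induction with
    | zero => simp
    | add f f' hf hf' => simp [Preadditive.comp_add, hf, hf']
    | smul a f hf => simp [hf]
    | path q => rw [← pathHom_comp, evalHom_pathHom, evalHom_pathHom, evalHom_pathHom,
        evalPath_comp]

end PathCategory

/-! ### A concrete form of standardness -/

section Standard

variable (k : Type w) [Field k] {C : Type u} [Category.{v} C] [Preadditive C] [Linear k C]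

/-- A linear functor out of the mesh category is determined by the images of the arrows. Fullness is
surjectivity of the evaluation, and faithfulness together with well-definedness is the description
of its kernel. -/
theorem isStandard_iff (S : Set C) : IsStandard k S ↔
    (∀ X ∈ S, TrivialAutField k X) ∧
      ∃ (σ : Polarization (vertexTau k S))
        (φ : ∀ ⦃X Y : Vertex k S⦄, (X ⟶ Y) → (X.obj ⟶ Y.obj)),
        ∀ X Y : Vertex k S, Function.Surjective (evalHom k φ X Y) ∧
          ∀ f, evalHom k φ X Y f = 0 ↔ f ∈ meshIdeal k σ (pathOb k X) (pathOb k Y) := by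
  refine and_congr_right fun _ => exists_congr fun σ => ⟨?_, ?_⟩
  · rintro ⟨F, hadd, hlin, heq, hobj⟩
    let Q := CategoryTheory.Quotient.functor (meshRel k σ)
    -- `F` fixes objects only up to a propositional equality. The isomorphic copy fixes them
    -- definitionally, so that its values on arrows have the required type.
    let F' : MeshCat k σ ⥤ FullSub k S :=
      F.copyObj (fun X => (X.as : Vertex k S)) fun X => eqToIso (hobj (X.as : Vertex k S))
    let i : F ≅ F' := F.isoCopyObj _ _
    have : F'.IsEquivalence := Functor.isEquivalence_of_iso i
    have : F'.Additive := Functor.additive_of_iso i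
    have : F'.Linear k := Functor.linear_of_iso k i
    have hzero : ∀ {A B : PathCat k (Vertex k S)} (f : A ⟶ B),
        F'.map (Q.map f) = 0 ↔ f ∈ meshIdeal k σ A B := by
      intro A B f
      rw [← F'.map_zero, F'.map_injective.eq_iff, ← Q.map_zero,
        CategoryTheory.Quotient.functor_map_eq_iff]
      change f - 0 ∈ _ ↔ _
      rw [sub_zero]
    let φ : ∀ ⦃X Y : Vertex k S⦄, (X ⟶ Y) → (X.obj ⟶ Y.obj) := fun X Y a =>
      (F'.map (Q.map (arrowMap k a))).hom
    have heval : ∀ (X Y : Vertex k S) (f : pathOb k X ⟶ pathOb k Y),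
        evalHom k φ X Y f = (F'.map (Q.map f)).hom := by
      intro X Y f
      induction f using pathHom_induction with
      | zero => simp only [map_zero, Functor.map_zero]; rfl
      | add f g hf hg => simp only [map_add, Functor.map_add, hf, hg]; rfl
      | smul a f hf => simp only [map_smul, Functor.map_smul, hf]; rfl
      | path p =>
        rw [evalHom_pathHom]
        induction p with
        | nil =>
          rw [pathHom_nil, Q.map_id, F'.map_id]; rfl
        | cons p a ih =>
          rw [pathHom_cons, Q.map_comp, F'.map_comp, evalPath, ih]; rfl
    refine ⟨φ, fun X Y => ⟨fun g => ?_, fun f => ?_⟩⟩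
    · obtain ⟨m, hm⟩ := F'.map_surjective (X := Q.obj (pathOb k X)) (Y := Q.obj (pathOb k Y)) ⟨g⟩
      obtain ⟨f, rfl⟩ := Q.map_surjective m
      exact ⟨f, by rw [heval, hm]⟩
    · rw [heval, ← hzero]
      exact ⟨fun h => InducedCategory.hom_ext h, fun h => congrArg InducedCategory.Hom.hom h⟩
  · rintro ⟨φ, hφ⟩
    let G : PathCat k (Vertex k S) ⥤ FullSub k S :=
      { obj := fun X => (X : Vertex k S)
        map := fun {X Y} f => ⟨evalHom k φ X Y f⟩
        map_id := fun X => InducedCategory.hom_ext (evalHom_id φ X)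
        map_comp := fun f g => InducedCategory.hom_ext (evalHom_comp φ f g) }
    let F : MeshCat k σ ⥤ FullSub k S := CategoryTheory.Quotient.lift _ G
      fun A B f g h => InducedCategory.hom_ext (sub_eq_zero.mp
        ((map_sub (evalHom k φ A B) f g).symm.trans (((hφ A B).2 _).mpr h)))
    let Q := CategoryTheory.Quotient.functor (meshRel k σ)
    refine ⟨F, ⟨?_⟩, ⟨?_⟩, ?_, fun X => rfl⟩
    · intro A B f g
      obtain ⟨f, rfl⟩ := Q.map_surjective f
      obtain ⟨g, rfl⟩ := Q.map_surjective g
      exact InducedCategory.hom_ext (map_add (evalHom k φ A.as B.as) f g)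
    · intro A B f a
      obtain ⟨f, rfl⟩ := Q.map_surjective f
      exact InducedCategory.hom_ext (map_smul (evalHom k φ A.as B.as) a f)
    · have : F.Full := ⟨fun {A B} g => by
        obtain ⟨f, hf⟩ := (hφ A.as B.as).1 g.hom
        exact ⟨Q.map f, InducedCategory.hom_ext hf⟩⟩
      have : F.Faithful := ⟨fun {A B} f g h => by
        obtain ⟨f, rfl⟩ := Q.map_surjective f
        obtain ⟨g, rfl⟩ := Q.map_surjective g
        exact CategoryTheory.Quotient.sound _ (((hφ A.as B.as).2 (f - g)).mp
          ((map_sub (evalHom k φ A.as B.as) f g).trans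
            (sub_eq_zero.mpr (congrArg InducedCategory.Hom.hom h))))⟩
      have : F.EssSurj := ⟨fun X => ⟨MeshCat.ofVertex k σ X, ⟨Iso.refl _⟩⟩⟩
      exact { }

end Standard

/-! ### The combinatorics of sections -/

section Parts

variable {C : Type u} [Category.{v} C] [Preadditive C]

theorem plusPart_subset {Γ Δ : Set C} : plusPart Γ Δ ⊆ Γ := by
  rintro X ⟨Y, hY, p⟩
  obtain ⟨Z, hZ, -⟩ := Relation.TransGen.head'_iff.mp p
  exact hZ.1

theorem minusPart_subset {Γ Δ : Set C} : minusPart Γ Δ ⊆ Γ := by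
  rintro X ⟨Y, hY, p⟩
  obtain ⟨Z, -, hZ⟩ := Relation.TransGen.tail'_iff.mp p
  exact hZ.2.1

end Parts

section Combinatorics

variable {k : Type w} [Field k] {C : Type u} [Category.{v} C] [Preadditive C] [Linear k C]

theorem arrowIn_of_hom {S : Set C} {X Y : Vertex k S} (a : X ⟶ Y) : ArrowIn k S X.obj Y.obj :=
  ⟨X.mem, Y.mem, a.pos⟩

theorem reflTransGen_of_path {S : Set C} {X Y : Vertex k S} (p : Quiver.Path X Y) :
    Relation.ReflTransGen (ArrowIn k S) X.obj Y.obj := by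
  induction p with
  | nil => exact .refl
  | cons p a ih => exact ih.tail (arrowIn_of_hom a)

theorem IsAcyclicSubquiver.isEmpty_hom {S : Set C} (h : IsAcyclicSubquiver k S)
    (X : Vertex k S) : IsEmpty (X ⟶ X) :=
  ⟨fun a => h X.obj (.single (arrowIn_of_hom a))⟩

theorem IsAcyclicSubquiver.path_eq_nil {S : Set C} (h : IsAcyclicSubquiver k S)
    {X : Vertex k S} : ∀ p : Quiver.Path X X, p = .nil
  | .nil => rfl
  | .cons p a => (h X.obj (.tail' (reflTransGen_of_path p) (arrowIn_of_hom a))).elim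

theorem IsConvexIn.transGen {Γ Δ : Set C} (h : IsConvexIn k Γ Δ) {X Y : C} (hX : X ∈ Δ)
    (hY : Y ∈ Δ) (p : Relation.TransGen (ArrowIn k Γ) X Y) :
    Relation.TransGen (ArrowIn k Δ) X Y := by
  induction p using Relation.TransGen.head_induction_on with
  | single h' => exact .single ⟨hX, hY, h'.2.2⟩
  | head h' p ih =>
    have := h.2 _ hX _ hY _ (.single h') p.to_reflTransGen
    exact .head ⟨hX, this, h'.2.2⟩ (ih this)

variable (k) in
/-- `Δ` is a section of `Γ`, and `τ` is an injective partial function on `Γ` which is compatible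
with the arrows. -/
structure IsTauSection (Γ Δ : Set C) : Prop where
  isSection : IsSection k Γ Δ
  path {X Z : C} (h : TauStep Γ Z X) : Relation.TransGen (ArrowIn k Γ) X Z
  tau_unique {X X' Z : C} (h : TauStep Γ Z X) (h' : TauStep Γ Z X') : X = X'
  tau_inj {X Z Z' : C} (h : TauStep Γ Z X) (h' : TauStep Γ Z' X) : Z = Z'

namespace IsTauSection

variable {Γ Δ : Set C} (h : IsTauSection k Γ Δ)

include h

theorem subset : Δ ⊆ Γ := h.isSection.2.1.1

theorem transGen_path {X Z : C} (p : Relation.TransGen (TauStep Γ) Z X) :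
    Relation.TransGen (ArrowIn k Γ) X Z := by
  induction p with
  | single h' => exact h.path h'
  | tail _ h' ih => exact (h.path h').trans ih

theorem mem_of_path {X Y Z : C} (hX : X ∈ Δ) (hZ : Z ∈ Δ)
    (p : Relation.ReflTransGen (ArrowIn k Γ) X Y) (q : Relation.ReflTransGen (ArrowIn k Γ) Y Z) :
    Y ∈ Δ := h.isSection.2.1.2 X hX Z hZ Y p q

/-- Two vertices of Δ in one τ-orbit coincide. A τ-chain from a vertex to itself reverses to an
oriented cycle, which convexity places in Δ. -/
theorem not_transGen {X Y : C} (hX : X ∈ Δ) (hY : Y ∈ Δ) :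
    ¬ Relation.TransGen (TauStep Γ) X Y := by
  intro p
  obtain rfl : X = Y := (h.isSection.2.2.2 X (h.subset hX)).unique ⟨hX, Or.inl .refl⟩
    ⟨hY, Or.inl p.to_reflTransGen⟩
  exact h.isSection.2.2.1 X (h.isSection.2.1.transGen hX hX (h.transGen_path p))

theorem notMem_plusPart {X : C} (hX : X ∈ Δ) : X ∉ plusPart Γ Δ :=
  fun ⟨_, hY, p⟩ => h.not_transGen hX hY p

theorem notMem_minusPart {X : C} (hX : X ∈ Δ) : X ∉ minusPart Γ Δ :=
  fun ⟨_, hY, p⟩ => h.not_transGen hY hX p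

theorem trichotomy {X : C} (hX : X ∈ Γ) : X ∈ Δ ∨ X ∈ plusPart Γ Δ ∨ X ∈ minusPart Γ Δ := by
  obtain ⟨Y, ⟨hY, hXY⟩, -⟩ := h.isSection.2.2.2 X hX
  rcases hXY with p | p
  · rcases Relation.reflTransGen_iff_eq_or_transGen.mp p with rfl | p
    · exact Or.inl hY
    · exact Or.inr (Or.inl ⟨Y, hY, p⟩)
  · rcases Relation.reflTransGen_iff_eq_or_transGen.mp p with rfl | p
    · exact Or.inl hY
    · exact Or.inr (Or.inr ⟨Y, hY, p⟩)

theorem exists_path_of_notMem_minusPart {X : C} (hX : X ∈ Γ) (hX' : X ∉ minusPart Γ Δ) :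
    ∃ Y ∈ Δ, Relation.ReflTransGen (ArrowIn k Γ) Y X := by
  rcases h.trichotomy hX with hX | ⟨Y, hY, p⟩ | hX
  · exact ⟨X, hX, .refl⟩
  · exact ⟨Y, hY, (h.transGen_path p).to_reflTransGen⟩
  · exact absurd hX hX'

theorem exists_path_of_notMem_plusPart {X : C} (hX : X ∈ Γ) (hX' : X ∉ plusPart Γ Δ) :
    ∃ Y ∈ Δ, Relation.ReflTransGen (ArrowIn k Γ) X Y := by
  rcases h.trichotomy hX with hX | hX | ⟨Y, hY, p⟩
  · exact ⟨X, hX, .refl⟩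
  · exact absurd hX hX'
  · exact ⟨Y, hY, (h.transGen_path p).to_reflTransGen⟩

/-- Such a vertex would lie on a path from Δ to Δ, hence in Δ by convexity. -/
theorem notMem_minusPart_of_mem_plusPart {X : C} (hX : X ∈ plusPart Γ Δ) :
    X ∉ minusPart Γ Δ := by
  intro hX'
  obtain ⟨Y, hY, p⟩ := hX
  obtain ⟨Z, hZ, q⟩ := hX'
  exact h.notMem_plusPart (h.mem_of_path hY hZ (h.transGen_path p).to_reflTransGen
    (h.transGen_path q).to_reflTransGen) ⟨Y, hY, p⟩

/-- There are no paths from `Δ⁺` to `Δ ∪ Δ⁻`. -/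
theorem mem_plusPart_of_path {X Y : C} (hX : X ∈ plusPart Γ Δ) (hY : Y ∈ Γ)
    (p : Relation.ReflTransGen (ArrowIn k Γ) X Y) : Y ∈ plusPart Γ Δ := by
  by_contra hY'
  obtain ⟨Z, hZ, q⟩ := h.exists_path_of_notMem_plusPart hY hY'
  obtain ⟨X', hX', r⟩ := h.exists_path_of_notMem_minusPart (plusPart_subset hX)
    (h.notMem_minusPart_of_mem_plusPart hX)
  exact h.notMem_plusPart (h.mem_of_path hX' hZ r (p.trans q)) hX

/-- There are no paths from `Δ ∪ Δ⁺` to `Δ⁻`. -/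
theorem mem_minusPart_of_path {X Y : C} (hY : Y ∈ minusPart Γ Δ) (hX : X ∈ Γ)
    (p : Relation.ReflTransGen (ArrowIn k Γ) X Y) : X ∈ minusPart Γ Δ := by
  by_contra hX'
  obtain ⟨Z, hZ, q⟩ := h.exists_path_of_notMem_minusPart hX hX'
  obtain ⟨Y', hY', r⟩ := h.exists_path_of_notMem_plusPart (minusPart_subset hY)
    fun h' => h.notMem_minusPart_of_mem_plusPart h' hY
  exact h.notMem_minusPart (h.mem_of_path hZ hY' (q.trans p) r) hY

/-- As `τ` is single-valued, `X` is the first step of the τ-chain leading from `Z` down to Δ, so it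
lies in Δ or Δ⁺. -/
theorem tau_notMem_minusPart {X Z : C} (hXZ : TauStep Γ Z X) (hZ : Z ∈ plusPart Γ Δ) :
    X ∉ minusPart Γ Δ := by
  obtain ⟨Y, hY, p⟩ := hZ
  obtain ⟨X', hX', q⟩ := Relation.TransGen.head'_iff.mp p
  obtain rfl := h.tau_unique hXZ hX'
  rcases Relation.reflTransGen_iff_eq_or_transGen.mp q with rfl | q
  · exact h.notMem_minusPart hY
  · exact h.notMem_minusPart_of_mem_plusPart ⟨Y, hY, q⟩

theorem tau_mem_minusPart {X Z : C} (hXZ : TauStep Γ Z X) (hZ : Z ∉ plusPart Γ Δ) :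
    X ∈ minusPart Γ Δ := by
  rcases h.trichotomy hXZ.1 with hZ' | hZ' | ⟨Y, hY, p⟩
  · exact ⟨Z, hZ', .single hXZ⟩
  · exact absurd hZ' hZ
  · exact ⟨Y, hY, p.tail hXZ⟩

end IsTauSection

end Combinatorics

/-! ### Functoriality of path categories -/

section Functoriality

universe v₁ u₁ v₂ u₂

variable (k : Type w) [Field k] {V : Type u₁} [Quiver.{v₁} V] {V' : Type u₂} [Quiver.{v₂} V']
  (G : V ⥤q V')

/-- The linear functor between path categories induced by a prefunctor, on morphisms. -/
noncomputable def mapPathHom (X Y : V) :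
    (pathOb k X ⟶ pathOb k Y) →ₗ[k] (pathOb k (G.obj X) ⟶ pathOb k (G.obj Y)) :=
  evalHom k (obj := fun X => pathOb k (G.obj X)) (fun _ _ a => arrowMap k (G.map a)) X Y

variable {k}

theorem mapPathHom_pathHom {X Y : V} (p : Quiver.Path X Y) :
    mapPathHom k G X Y (pathHom k p) = pathHom k (G.mapPath p) := by
  refine (evalHom_pathHom _ p).trans ?_
  induction p with
  | nil => rfl
  | cons p a ih => rw [evalPath, ih, Prefunctor.mapPath_cons, pathHom_cons]

/-- Paths form a basis, and on coordinates the map is `Finsupp.mapDomain`. -/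
theorem mapPathHom_injective {X Y : V}
    (h : Function.Injective fun p : Quiver.Path X Y => G.mapPath p) :
    Function.Injective (mapPathHom k G X Y) := by
  have key : ∀ f : pathOb k X ⟶ pathOb k Y, mapPathHom k G X Y f =
      (Finsupp.mapDomain (fun p : Quiver.Path X Y => G.mapPath p) (f : Quiver.Path X Y →₀ k) :
        Quiver.Path (G.obj X) (G.obj Y) →₀ k) := by
    intro f
    induction f using pathHom_induction with
    | zero => exact (map_zero _).trans Finsupp.mapDomain_zero.symm
    | add f g hf hg =>
      refine (map_add _ f g).trans ?_
      rw [hf, hg]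
      exact Finsupp.mapDomain_add.symm
    | smul a f hf =>
      refine (map_smul _ a f).trans ?_
      rw [hf]
      exact (Finsupp.mapDomain_smul a _).symm
    | path p =>
      rw [mapPathHom_pathHom]
      exact Finsupp.mapDomain_single.symm
  intro f g hfg
  rw [key, key] at hfg
  exact Finsupp.mapDomain_injective h hfg

variable {C : Type u} [Category.{v} C] {obj : V' → C}
  (φ : ∀ ⦃X Y : V'⦄, (X ⟶ Y) → (obj X ⟶ obj Y))

theorem evalPath_mapPath {X Y : V} (p : Quiver.Path X Y) :
    evalPath φ (G.mapPath p) =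
      evalPath (obj := fun X => obj (G.obj X)) (fun _ _ a => φ (G.map a)) p := by
  induction p with
  | nil => rfl
  | cons p a ih => rw [Prefunctor.mapPath_cons, evalPath, evalPath, ih]

theorem evalHom_mapPathHom [Preadditive C] [Linear k C] {X Y : V}
    (f : pathOb k X ⟶ pathOb k Y) :
    evalHom k φ _ _ (mapPathHom k G X Y f) =
      evalHom k (obj := fun X => obj (G.obj X)) (fun _ _ a => φ (G.map a)) X Y f := by
  induction f using pathHom_induction with
  | zero => simp only [map_zero]
  | add f g hf hg => simp only [map_add, hf, hg]
  | smul a f hf => simp only [map_smul, hf]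
  | path p => rw [mapPathHom_pathHom, evalHom_pathHom, evalHom_pathHom, evalPath_mapPath]

end Functoriality

/-! ### Path categories of convex subquivers -/

section Convex

variable {k : Type w} [Field k] {C : Type u} [Category.{v} C] [Preadditive C] [Linear k C]
  {Γ Δ : Set C} (hsub : Δ ⊆ Γ)

variable (k) in
/-- The inclusion of a full subquiver. -/
noncomputable def vertexIncl : Vertex k Δ ⥤q Vertex k Γ where
  obj X := ⟨X.obj, hsub X.mem⟩
  map {X Y} a := (a : Fin (numArrows k X.obj Y.obj))

theorem vertexIncl_mapPath_injective {X Y : Vertex k Δ} (p q : Quiver.Path X Y)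
    (h : (vertexIncl k hsub).mapPath p = (vertexIncl k hsub).mapPath q) : p = q := by
  have hobj : ∀ A B : Vertex k Δ, (vertexIncl k hsub).obj A = (vertexIncl k hsub).obj B →
      A = B := fun A B e => Vertex.ext (congrArg (Vertex.obj (S := Γ)) e)
  induction p with
  | nil =>
    cases q with
    | nil => rfl
    | cons q a => simp [Prefunctor.mapPath] at h
  | cons p a ih =>
    cases q with
    | nil => simp [Prefunctor.mapPath] at h
    | cons q b =>
      obtain rfl := hobj _ _ (Quiver.Path.obj_eq_of_cons_eq_cons h)
      rw [ih q (eq_of_heq (Quiver.Path.heq_of_cons_eq_cons h))]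
      congr 1
      exact eq_of_heq (Quiver.Path.hom_heq_of_cons_eq_cons
        (p := (vertexIncl k hsub).mapPath p) (p' := (vertexIncl k hsub).mapPath q)
        (e := (vertexIncl k hsub).map a) (e' := (vertexIncl k hsub).map b) h)

theorem IsConvexIn.exists_mapPath_eq (h : IsConvexIn k Γ Δ) {X : Vertex k Δ} {Y' : Vertex k Γ}
    (p : Quiver.Path ((vertexIncl k h.1).obj X) Y') (hY : Y'.obj ∈ Δ) :
    ∃ q : Quiver.Path X ⟨Y'.obj, hY⟩, (vertexIncl k h.1).mapPath q = p := by
  induction p with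
  | nil => exact ⟨.nil, rfl⟩
  | @cons W Y' p a ih =>
    have hW : W.obj ∈ Δ := h.2 _ X.mem _ hY _ (reflTransGen_of_path p)
      (.single (arrowIn_of_hom a))
    obtain ⟨q, rfl⟩ := ih hW
    exact ⟨q.cons (show (⟨W.obj, hW⟩ : Vertex k Δ) ⟶ ⟨Y'.obj, hY⟩ from a), rfl⟩

theorem IsConvexIn.mapPathHom_surjective (h : IsConvexIn k Γ Δ) (X Y : Vertex k Δ) :
    Function.Surjective (mapPathHom k (vertexIncl k h.1) X Y) := by
  intro f
  induction f using pathHom_induction with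
  | zero => exact ⟨0, map_zero _⟩
  | add f g hf hg =>
    obtain ⟨f, rfl⟩ := hf
    obtain ⟨g, rfl⟩ := hg
    exact ⟨f + g, map_add _ f g⟩
  | smul a f hf =>
    obtain ⟨f, rfl⟩ := hf
    exact ⟨a • f, map_smul _ a f⟩
  | path p =>
    obtain ⟨q, rfl⟩ := h.exists_mapPath_eq p Y.mem
    exact ⟨pathHom k q, mapPathHom_pathHom _ q⟩

end Convex

/-! ### Morphisms of path categories and their last and first arrows -/

section Arrows

universe v₁ u₁

variable (k : Type w) [Field k] {V : Type u₁} [Quiver.{v₁} V]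

open scoped Classical in
/-- The identity if `X = Y`, and zero otherwise. -/
noncomputable def diagHom (X Y : V) : pathOb k X ⟶ pathOb k Y :=
  if h : X = Y then eqToHom (congrArg _ h) else 0

@[simp]
theorem diagHom_self (X : V) : diagHom k X X = 𝟙 (pathOb k X) := by simp [diagHom]

theorem diagHom_of_ne {X Y : V} (h : X ≠ Y) : diagHom k X Y = 0 := by simp [diagHom, h]

variable {k} {tau : V → V → Prop} (σ : Polarization tau) {X Z : V} (h : tau X Z)

theorem meshElement_mem : meshElement k σ h ∈ meshIdeal k σ (pathOb k X) (pathOb k Z) :=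
  Submodule.subset_span ⟨X, Z, h, 𝟙 _, 𝟙 _, by simp⟩

variable [Fintype (Σ Y : V, (Y ⟶ Z))]

theorem meshElement_eq_sum : meshElement k σ h =
    ∑ b : (Σ Y : V, (Y ⟶ Z)), arrowMap k (σ h b.1 b.2) ≫ arrowMap k b.2 :=
  finsum_eq_sum_of_fintype _

theorem exists_eq_add_sum_comp_arrowMap {S : V} (f : pathOb k S ⟶ pathOb k Z) :
    ∃ (l : k) (w : ∀ b : (Σ Y : V, (Y ⟶ Z)), pathOb k S ⟶ pathOb k b.1),
      f = l • diagHom k S Z + ∑ b, w b ≫ arrowMap k b.2 := by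
  classical
  induction f using pathHom_induction with
  | zero => exact ⟨0, fun _ => 0, by simp⟩
  | add f g hf hg =>
    obtain ⟨l, w, rfl⟩ := hf
    obtain ⟨l', w', rfl⟩ := hg
    refine ⟨l + l', fun b => w b + w' b, ?_⟩
    simp only [Preadditive.add_comp, Finset.sum_add_distrib, add_smul]
    abel
  | smul a f hf =>
    obtain ⟨l, w, rfl⟩ := hf
    refine ⟨a * l, fun b => a • w b, ?_⟩
    simp only [Linear.smul_comp, mul_smul, smul_add, Finset.smul_sum]
  | path p =>
    cases p with
    | nil => exact ⟨1, fun _ => 0, by simp [pathHom_nil]⟩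
    | cons p a =>
      refine ⟨0, Pi.single ⟨_, a⟩ (pathHom k p), ?_⟩
      rw [zero_smul, zero_add, Finset.sum_eq_single ⟨_, a⟩, Pi.single_eq_same, pathHom_cons]
      · intro b _ hb
        rw [Pi.single_eq_of_ne hb, zero_comp]
      · simp

/-- Splits off the first arrow of each path; bijectivity of `σ` lets the arrows out of `X` be
indexed by those into `Z`. Unlike splitting off the last arrow, this needs an induction, because
paths grow at their end. -/
theorem exists_eq_add_sum_arrowMap_comp {T : V} (f : pathOb k X ⟶ pathOb k T) :
    ∃ (l : k) (w : ∀ b : (Σ Y : V, (Y ⟶ Z)), pathOb k b.1 ⟶ pathOb k T),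
      f = l • diagHom k X T + ∑ b, arrowMap k (σ h b.1 b.2) ≫ w b := by
  classical
  have hsmul : ∀ {T : V} (a : k) (f : pathOb k X ⟶ pathOb k T),
      (∃ (l : k) (w : ∀ b : (Σ Y : V, (Y ⟶ Z)), pathOb k b.1 ⟶ pathOb k T),
        f = l • diagHom k X T + ∑ b, arrowMap k (σ h b.1 b.2) ≫ w b) →
      ∃ (l : k) (w : ∀ b : (Σ Y : V, (Y ⟶ Z)), pathOb k b.1 ⟶ pathOb k T),
        a • f = l • diagHom k X T + ∑ b, arrowMap k (σ h b.1 b.2) ≫ w b := by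
    rintro T a _ ⟨l, w, rfl⟩
    refine ⟨a * l, fun b => a • w b, ?_⟩
    simp only [Linear.comp_smul, mul_smul, smul_add, Finset.smul_sum]
  have hadd : ∀ {T : V} (f g : pathOb k X ⟶ pathOb k T),
      (∃ (l : k) (w : ∀ b : (Σ Y : V, (Y ⟶ Z)), pathOb k b.1 ⟶ pathOb k T),
        f = l • diagHom k X T + ∑ b, arrowMap k (σ h b.1 b.2) ≫ w b) →
      (∃ (l : k) (w : ∀ b : (Σ Y : V, (Y ⟶ Z)), pathOb k b.1 ⟶ pathOb k T),
        g = l • diagHom k X T + ∑ b, arrowMap k (σ h b.1 b.2) ≫ w b) →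
      ∃ (l : k) (w : ∀ b : (Σ Y : V, (Y ⟶ Z)), pathOb k b.1 ⟶ pathOb k T),
        f + g = l • diagHom k X T + ∑ b, arrowMap k (σ h b.1 b.2) ≫ w b := by
    rintro T _ _ ⟨l, w, rfl⟩ ⟨l', w', rfl⟩
    refine ⟨l + l', fun b => w b + w' b, ?_⟩
    simp only [Preadditive.comp_add, Finset.sum_add_distrib, add_smul]
    abel
  induction f using pathHom_induction with
  | zero => exact ⟨0, fun _ => 0, by simp⟩
  | add f g hf hg => exact hadd f g hf hg
  | smul a f hf => exact hsmul a f hf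
  | path p =>
    induction p with
    | nil => exact ⟨1, fun _ => 0, by simp [pathHom_nil]⟩
    | @cons Y T p a ih =>
      obtain ⟨l, w, e⟩ := ih
      rw [pathHom_cons, e, Preadditive.add_comp]
      refine hadd _ _ ?_ ⟨0, fun b => w b ≫ arrowMap k a, by simp [Preadditive.sum_comp]⟩
      rw [Linear.smul_comp]
      refine hsmul l _ ?_
      -- The constant term of the shorter path survives only if that path can be trivial; then `a`
      -- is itself the first arrow.
      by_cases hXY : X = Y
      · subst hXY
        refine ⟨0, Pi.single ⟨T, (σ h T).symm a⟩ (𝟙 (pathOb k T)), ?_⟩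
        rw [diagHom_self, Category.id_comp, zero_smul, zero_add,
          Finset.sum_eq_single ⟨T, (σ h T).symm a⟩, Pi.single_eq_same]
        · simp
        · intro b _ hb
          rw [Pi.single_eq_of_ne hb, comp_zero]
        · simp
      · exact ⟨0, fun _ => 0, by simp [diagHom_of_ne k hXY]⟩

theorem meshIdeal_eq_bot {A B : V}
    (hAB : ∀ X Z, tau X Z → Quiver.Path A X → Quiver.Path Z B → False) :
    meshIdeal k σ (pathOb k A) (pathOb k B) = ⊥ := by
  refine Submodule.span_eq_bot.mpr ?_
  rintro _ ⟨X, Z, h, p, q, rfl⟩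
  by_cases hp : IsEmpty (Quiver.Path A X)
  · rw [hom_eq_zero_of_isEmpty hp p, zero_comp]
  · by_cases hq : IsEmpty (Quiver.Path Z B)
    · rw [hom_eq_zero_of_isEmpty hq q, comp_zero, comp_zero]
    · exact (hAB X Z h (not_isEmpty_iff.mp hp).some (not_isEmpty_iff.mp hq).some).elim

end Arrows

/-! ### Comparison of morphism spaces along meshes -/

theorem mem_rad_of_ne {k : Type w} [Field k] {C : Type u} [Category.{v} C] [Preadditive C]
    [Linear k C] {V : Type*} {obj : V → C} (hloc : ∀ X, IsLocalObj (obj X))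
    (hinj : ∀ X Y, Nonempty (obj X ≅ obj Y) → X = Y) {X Y : V} (h : X ≠ Y)
    (f : obj X ⟶ obj Y) : f ∈ rad k (obj X) (obj Y) := by
  by_contra hf
  have := (hloc X).isIso_of_notMem_rad (hloc Y) hf
  exact h (hinj X Y ⟨asIso f⟩)

section Comparison

universe v₁ u₁

variable {k : Type w} [Field k] {V : Type u₁} [Quiver.{v₁} V] {tau : V → V → Prop}
  (σ : Polarization tau)
  {C : Type u} [Category.{v} C] [Preadditive C] [Linear k C] {obj : V → C}
  (φ : ∀ ⦃X Y : V⦄, (X ⟶ Y) → (obj X ⟶ obj Y))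

variable (k) in
/-- The evaluation of paths identifies the morphisms from `X` to `Y` in the mesh category with
those in `C`, except that it is not required to be well-defined on the mesh category. -/
def EvalBijective (X Y : V) : Prop :=
  Function.Surjective (evalHom k φ X Y) ∧
    ∀ f, evalHom k φ X Y f = 0 → f ∈ meshIdeal k σ (pathOb k X) (pathOb k Y)

theorem EvalBijective.of_isEmpty {X Y : V} (h : IsEmpty (Quiver.Path X Y))
    (h' : ∀ f : obj X ⟶ obj Y, f = 0) : EvalBijective k σ φ X Y :=
  ⟨fun f => ⟨0, by rw [map_zero, h' f]⟩, fun f _ => by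
    rw [hom_eq_zero_of_isEmpty h f]; exact zero_mem _⟩

theorem evalHom_eq_zero_of_mem_meshIdeal
    (hσ : ∀ (X Z : V) (h : tau X Z), evalHom k φ X Z (meshElement k σ h) = 0) {X Y : V}
    {f : pathOb k X ⟶ pathOb k Y} (hf : f ∈ meshIdeal k σ (pathOb k X) (pathOb k Y)) :
    evalHom k φ X Y f = 0 := by
  have : meshIdeal k σ (pathOb k X) (pathOb k Y) ≤ LinearMap.ker (evalHom k φ X Y) := by
    refine Submodule.span_le.mpr ?_
    rintro _ ⟨A, B, h, p, q, rfl⟩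
    rw [SetLike.mem_coe, LinearMap.mem_ker]
    refine (evalHom_comp φ _ _).trans ?_
    rw [evalHom_comp φ (meshElement k σ h) q, hσ, zero_comp, comp_zero]
  exact this hf

variable (hloc : ∀ X, IsLocalObj (obj X)) (hsc : ∀ X, ScalarEnd k (obj X))
  (hinj : ∀ X Y, Nonempty (obj X ≅ obj Y) → X = Y)

include hloc in
theorem smul_diagHom_eq_zero {X Y : V} {l : k}
    (h : l • evalHom k φ X Y (diagHom k X Y) ∈ rad k (obj X) (obj Y)) : l • diagHom k X Y = 0 := by
  by_cases hXY : X = Y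
  · subst hXY
    rw [diagHom_self, evalHom_id] at h
    rw [smul_id_mem_rad (hloc X).id_ne_zero h, zero_smul]
  · rw [diagHom_of_ne k hXY, smul_zero]

include hloc hsc hinj

theorem exists_sub_smul_diagHom_mem_rad {X Y : V} (f : obj X ⟶ obj Y) :
    ∃ l : k, f - l • evalHom k φ X Y (diagHom k X Y) ∈ rad k (obj X) (obj Y) := by
  by_cases hXY : X = Y
  · subst hXY
    rw [diagHom_self, evalHom_id]
    exact hsc X f
  · exact ⟨0, mem_rad_of_ne hloc hinj hXY _⟩

variable {X Z : V} (h : tau X Z) [Fintype (Σ Y : V, (Y ⟶ Z))]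
  (hmesh : IsMesh k (fun b : (Σ Y : V, (Y ⟶ Z)) => φ (σ h b.1 b.2)) (fun b => φ b.2))

include hmesh

/-- Surjectivity: up to a multiple of the identity, a morphism to `Z` is radical and factors through
the mesh. Injectivity: the coefficients of an element of the kernel factor through `X`, by the
pseudo-kernel property, and a multiple of the mesh relation corrects them. Of the comparison at `X`
only surjectivity is used. -/
theorem EvalBijective.of_mesh_right (hrad : ∀ b : (Σ Y : V, (Y ⟶ Z)), φ b.2 ∈ rad k _ _) {S : V}
    (hS : ∀ b : (Σ Y : V, (Y ⟶ Z)), EvalBijective k σ φ S b.1)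
    (hX : EvalBijective k σ φ S X) : EvalBijective k σ φ S Z := by
  constructor
  · intro g
    obtain ⟨l, hl⟩ := exists_sub_smul_diagHom_mem_rad φ hloc hsc hinj g
    obtain ⟨w, hw⟩ := hmesh.exists_sum_comp_eq hl
    choose f hf using fun b => (hS b).1 (w b)
    refine ⟨l • diagHom k S Z + ∑ b, f b ≫ arrowMap k b.2, ?_⟩
    rw [map_add, map_smul, map_sum]
    simp only [evalHom_comp, evalHom_arrowMap, hf]
    rw [hw]
    abel
  · intro f hf
    obtain ⟨l, w, rfl⟩ := exists_eq_add_sum_comp_arrowMap f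
    simp only [map_add, map_smul, map_sum, evalHom_comp, evalHom_arrowMap] at hf
    have hl : l • diagHom k S Z = 0 := smul_diagHom_eq_zero φ hloc (by
      rw [eq_neg_of_add_eq_zero_left hf]
      exact neg_mem (Submodule.sum_mem _ fun b _ => comp_mem_rad _ (hrad b)))
    rw [← map_smul, hl, map_zero, zero_add] at hf
    obtain ⟨m, hm⟩ := hmesh.exists_of_sum_comp_eq_zero _ hf
    obtain ⟨m, rfl⟩ := hX.1 m
    -- Subtracting `m` times the mesh relation leaves coefficients that evaluate to zero, to which
    -- the hypothesis at the middle vertices applies.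
    have e : ∑ b, w b ≫ arrowMap k b.2 =
        ∑ b, (w b - m ≫ arrowMap k (σ h b.1 b.2)) ≫ arrowMap k b.2 + m ≫ meshElement k σ h := by
      rw [meshElement_eq_sum, Preadditive.comp_sum, ← Finset.sum_add_distrib]
      refine Finset.sum_congr rfl fun b _ => ?_
      simp [Preadditive.sub_comp]
    rw [hl, zero_add, e]
    refine add_mem (Submodule.sum_mem _ fun b _ => meshIdeal_comp k σ ((hS b).2 _ ?_) _)
      (comp_meshIdeal k σ (meshElement_mem σ h) m)
    rw [map_sub, evalHom_comp, evalHom_arrowMap, hm b, sub_self]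

/-- Dual to `EvalBijective.of_mesh_right`, with the pseudo-cokernel property and the source
morphism. -/
theorem EvalBijective.of_mesh_left
    (hrad : ∀ b : (Σ Y : V, (Y ⟶ Z)), φ (σ h b.1 b.2) ∈ rad k _ _) {T : V}
    (hT : ∀ b : (Σ Y : V, (Y ⟶ Z)), EvalBijective k σ φ b.1 T)
    (hZ : EvalBijective k σ φ Z T) : EvalBijective k σ φ X T := by
  constructor
  · intro g
    obtain ⟨l, hl⟩ := exists_sub_smul_diagHom_mem_rad φ hloc hsc hinj g
    obtain ⟨w, hw⟩ := hmesh.exists_comp_sum_eq hl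
    choose f hf using fun b => (hT b).1 (w b)
    refine ⟨l • diagHom k X T + ∑ b, arrowMap k (σ h b.1 b.2) ≫ f b, ?_⟩
    rw [map_add, map_smul, map_sum]
    simp only [evalHom_comp, evalHom_arrowMap, hf]
    rw [hw]
    abel
  · intro f hf
    obtain ⟨l, w, rfl⟩ := exists_eq_add_sum_arrowMap_comp σ h f
    simp only [map_add, map_smul, map_sum, evalHom_comp, evalHom_arrowMap] at hf
    have hl : l • diagHom k X T = 0 := smul_diagHom_eq_zero φ hloc (by
      rw [eq_neg_of_add_eq_zero_left hf]
      exact neg_mem (Submodule.sum_mem _ fun b _ => mem_rad_comp (hrad b) _))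
    rw [← map_smul, hl, map_zero, zero_add] at hf
    obtain ⟨m, hm⟩ := hmesh.exists_of_comp_sum_eq_zero _ hf
    obtain ⟨m, rfl⟩ := hZ.1 m
    have e : ∑ b, arrowMap k (σ h b.1 b.2) ≫ w b =
        ∑ b, arrowMap k (σ h b.1 b.2) ≫ (w b - arrowMap k b.2 ≫ m) + meshElement k σ h ≫ m := by
      rw [meshElement_eq_sum, Preadditive.sum_comp, ← Finset.sum_add_distrib]
      refine Finset.sum_congr rfl fun b _ => ?_
      simp [Preadditive.comp_sub]
    rw [hl, zero_add, e]
    refine add_mem (Submodule.sum_mem _ fun b _ => comp_meshIdeal k σ ((hT b).2 _ ?_) _)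
      (meshIdeal_comp k σ (meshElement_mem σ h) m)
    rw [map_sub, evalHom_comp, evalHom_arrowMap, hm b, sub_self]

end Comparison

/-! ### Components with trivial automorphism fields -/

section MeshComponent

variable (k : Type w) [Field k] {C : Type u} [Category.{v} C] [Preadditive C] [Linear k C]

/-- A component with trivial automorphism fields, in terms of what is needed of it in order to
compare its mesh category with `C`. -/
structure IsMeshComponent (Γ : Set C) : Prop where
  homFinite : HomFinite k C
  isLocalObj (X : Vertex k Γ) : IsLocalObj X.obj
  scalarEnd (X : Vertex k Γ) : ScalarEnd k X.obj
  eq_of_iso (X Y : Vertex k Γ) (h : Nonempty (X.obj ≅ Y.obj)) : X = Y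
  mesh {X Z : Vertex k Γ} {Y : C} {f : X.obj ⟶ Y} {g : Y ⟶ Z.obj}
    (h : IsAlmostSplitSequence f g) : MeshDecomposition k Γ X Z f g

variable {k}

theorem IsComponent.isMeshComponent [HasFiniteBiproducts C] (hfin : HomFinite k C)
    (hKS : KrullSchmidt C) {ind Γ : Set C} (hind : IsVertexSet ind) (hΓ : IsComponent k ind Γ)
    (htriv : ∀ X ∈ Γ, TrivialAutField k X) : IsMeshComponent k Γ where
  homFinite := hfin
  isLocalObj X := isLocalObj_of_isIndec hKS (hind.1 _ (hΓ.subset X.mem))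
  scalarEnd X := (trivialAutField_iff (isLocalObj_of_isIndec hKS (hind.1 _ (hΓ.subset X.mem)))).mp
    (htriv _ X.mem)
  eq_of_iso X Y := fun ⟨e⟩ =>
    Vertex.ext (hind.eq_of_iso (hΓ.subset X.mem) (hΓ.subset Y.mem) e)
  mesh h := h.meshDecomposition hfin hKS hind hΓ htriv

namespace IsMeshComponent

variable {Γ : Set C} (h : IsMeshComponent k Γ)

include h

theorem exists_arrows {X Z : Vertex k Γ} (hXZ : vertexTau k Γ X Z) :
    ∃ W : Vertex k Γ, Nonempty (X ⟶ W) ∧ Nonempty (W ⟶ Z) := by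
  obtain ⟨Y, f, g, hfg⟩ := hXZ
  obtain ⟨W, a⟩ := (h.mesh hfg).nonempty
  exact ⟨W, ⟨a⟩, ⟨finCongr ((h.mesh hfg).numArrows_eq W).symm a⟩⟩

theorem nonempty_polarization : Nonempty (Polarization (vertexTau k Γ)) := by
  refine ⟨fun X Z hXZ W => finCongr ?_⟩
  obtain ⟨Y, f, g, hfg⟩ := hXZ
  exact (h.mesh hfg).numArrows_eq W

theorem finite_arrows {X Z : Vertex k Γ} (hXZ : vertexTau k Γ X Z) :
    Finite (Σ W : Vertex k Γ, (W ⟶ Z)) := by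
  obtain ⟨σ⟩ := h.nonempty_polarization
  obtain ⟨Y, f, g, hfg⟩ := id hXZ
  have := (h.mesh hfg).finite
  exact Finite.of_equiv _ (Equiv.sigmaCongrRight (σ hXZ)).symm

/-- The middle term of an almost split sequence is non-zero, which provides the path; uniqueness of
almost split sequences makes `τ` single-valued and injective. -/
theorem isTauSection {Δ : Set C} (hΔ : IsSection k Γ Δ) : IsTauSection k Γ Δ where
  isSection := hΔ
  path {X Z} hXZ := by
    obtain ⟨W, ⟨a⟩, ⟨b⟩⟩ := h.exists_arrows (X := ⟨X, hXZ.2.1⟩) (Z := ⟨Z, hXZ.1⟩) hXZ.2.2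
    exact .tail (.single (arrowIn_of_hom a)) (arrowIn_of_hom b)
  tau_unique {X X' Z} hXZ hXZ' := by
    obtain ⟨hZ, hX, Y, f, g, hfg⟩ := hXZ
    obtain ⟨-, hX', Y', f', g', hfg'⟩ := hXZ'
    exact congrArg Vertex.obj (h.eq_of_iso ⟨X, hX⟩ ⟨X', hX'⟩
      (hfg.nonempty_iso_left hfg' (h.isLocalObj ⟨X, hX⟩) (h.isLocalObj ⟨X', hX'⟩)
        (h.isLocalObj ⟨Z, hZ⟩)))
  tau_inj {X Z Z'} hXZ hXZ' := by
    obtain ⟨hZ, hX, Y, f, g, hfg⟩ := hXZ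
    obtain ⟨hZ', -, Y', f', g', hfg'⟩ := hXZ'
    exact congrArg Vertex.obj (h.eq_of_iso ⟨Z, hZ⟩ ⟨Z', hZ'⟩
      (hfg.nonempty_iso_right hfg' (h.isLocalObj ⟨X, hX⟩) (h.isLocalObj ⟨Z, hZ⟩)
        (h.isLocalObj ⟨Z', hZ'⟩)))

variable (σ : Polarization (vertexTau k Γ)) {X Z : Vertex k Γ} (hXZ : vertexTau k Γ X Z)
  [Fintype (Σ W : Vertex k Γ, (W ⟶ Z))]

include σ hXZ in
theorem nonempty_decomposition : ∃ (Y : C) (f : X.obj ⟶ Y) (g : Y ⟶ Z.obj),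
    IsAlmostSplitSequence f g ∧
      Nonempty (Decomposition Y fun b : Σ W : Vertex k Γ, (W ⟶ Z) => b.1.obj) := by
  obtain ⟨Y, f, g, hfg⟩ := id hXZ
  let e := Equiv.sigmaCongrRight (σ hXZ)
  have : Fintype (Σ W : Vertex k Γ, (X ⟶ W)) := Fintype.ofEquiv _ e
  obtain ⟨D⟩ := (h.mesh hfg).decomposition
  exact ⟨Y, f, g, hfg, ⟨D.reindex e fun b => Iso.refl _⟩⟩

theorem exists_isMesh_right (φ : ∀ W : Vertex k Γ, (X ⟶ W) → (X.obj ⟶ W.obj))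
    (hφ : ∀ W, Nonempty (X ⟶ W) → SpansIrr k (φ W)) :
    ∃ ψ : ∀ W : Vertex k Γ, (W ⟶ Z) → (W.obj ⟶ Z.obj), (∀ W, SpansIrr k (ψ W)) ∧
      IsMesh k (fun b : (Σ W : Vertex k Γ, (W ⟶ Z)) => φ b.1 (σ hXZ b.1 b.2))
        (fun b => ψ b.1 b.2) := by
  obtain ⟨Y, f, g, hfg, ⟨D⟩⟩ := h.nonempty_decomposition σ hXZ
  exact hfg.exists_isMesh_right h.homFinite (h.isLocalObj X) (h.isLocalObj Z) h.isLocalObj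
    h.scalarEnd h.eq_of_iso D (fun W b => φ W (σ hXZ W b))
    fun b => (hφ b.1 ⟨σ hXZ b.1 b.2⟩).comp_equiv (σ hXZ b.1)

theorem exists_isMesh_left (ψ : ∀ W : Vertex k Γ, (W ⟶ Z) → (W.obj ⟶ Z.obj))
    (hψ : ∀ W, Nonempty (W ⟶ Z) → SpansIrr k (ψ W)) :
    ∃ φ : ∀ W : Vertex k Γ, (X ⟶ W) → (X.obj ⟶ W.obj), (∀ W, SpansIrr k (φ W)) ∧
      IsMesh k (fun b : (Σ W : Vertex k Γ, (W ⟶ Z)) => φ b.1 (σ hXZ b.1 b.2))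
        (fun b => ψ b.1 b.2) := by
  obtain ⟨Y, f, g, hfg, ⟨D⟩⟩ := h.nonempty_decomposition σ hXZ
  obtain ⟨φ, hφ, hm⟩ := hfg.exists_isMesh_left h.homFinite (h.isLocalObj X) (h.isLocalObj Z)
    h.isLocalObj h.scalarEnd h.eq_of_iso D ψ fun b => hψ b.1 ⟨b.2⟩
  refine ⟨fun W a => φ W ((σ hXZ W).symm a), fun W => (hφ W).comp_equiv (σ hXZ W).symm, ?_⟩
  simpa using hm

end IsMeshComponent

/-! ### Standard components have standard sections -/

namespace IsTauSection

variable {Γ Δ : Set C} (h : IsTauSection k Γ Δ)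

include h

theorem not_vertexTau (X Z : Vertex k Δ) : ¬ vertexTau k Δ X Z := fun hXZ =>
  h.not_transGen Z.mem X.mem (.single ⟨h.subset Z.mem, h.subset X.mem, hXZ⟩)

/-- A mesh contributing between `A` and `B` would give a path A → τZ → Z → B, placing two vertices
of one τ-orbit in Δ. -/
theorem meshIdeal_eq_bot_of_mem (σ : Polarization (vertexTau k Γ)) {A B : Vertex k Γ}
    (hA : A.obj ∈ Δ) (hB : B.obj ∈ Δ) : meshIdeal k σ (pathOb k A) (pathOb k B) = ⊥ := by
  refine meshIdeal_eq_bot σ fun X Z hXZ p q => ?_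
  have hp := reflTransGen_of_path p
  have hq := reflTransGen_of_path q
  have hs : TauStep Γ Z.obj X.obj := ⟨Z.mem, X.mem, hXZ⟩
  have hτ := (h.path hs).to_reflTransGen
  exact h.not_transGen (h.mem_of_path hA hB (hp.trans hτ) hq)
    (h.mem_of_path hA hB hp (hτ.trans hq)) (.single hs)

theorem meshIdeal_section_eq_bot (σ : Polarization (vertexTau k Δ)) (A B : Vertex k Δ) :
    meshIdeal k σ (pathOb k A) (pathOb k B) = ⊥ :=
  meshIdeal_eq_bot σ fun X Z hXZ _ _ => h.not_vertexTau X Z hXZ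

/-- By convexity, Δ and Γ have the same paths between vertices of Δ, and both mesh ideals vanish
there, so the evaluation on Γ simply restricts. -/
theorem isStandard_of_isStandard (hst : IsStandard k Γ) : IsStandard k Δ := by
  rw [isStandard_iff] at hst ⊢
  obtain ⟨htriv, σ, φ, hφ⟩ := hst
  let σ' : Polarization (vertexTau k Δ) := fun X Z hXZ => (h.not_vertexTau X Z hXZ).elim
  let φ' : ∀ ⦃X Y : Vertex k Δ⦄, (X ⟶ Y) → (X.obj ⟶ Y.obj) :=
    fun X Y a => φ ((vertexIncl k h.subset).map a)
  have key : ∀ (X Y : Vertex k Δ) (f : pathOb k X ⟶ pathOb k Y),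
      evalHom k φ _ _ (mapPathHom k (vertexIncl k h.subset) X Y f) = evalHom k φ' X Y f :=
    fun X Y f => evalHom_mapPathHom (k := k) (vertexIncl k h.subset) φ f
  refine ⟨fun X hX => htriv X (h.subset hX), σ', φ', fun X Y => ⟨fun g => ?_, fun f => ?_⟩⟩
  · obtain ⟨f, hf⟩ := (hφ ⟨X.obj, h.subset X.mem⟩ ⟨Y.obj, h.subset Y.mem⟩).1 g
    obtain ⟨f, rfl⟩ := h.isSection.2.1.mapPathHom_surjective X Y f
    exact ⟨f, (key X Y f).symm.trans hf⟩
  · have h₁ := (hφ ((vertexIncl k h.subset).obj X) ((vertexIncl k h.subset).obj Y)).2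
      (mapPathHom k (vertexIncl k h.subset) X Y f)
    rw [h.meshIdeal_eq_bot_of_mem σ X.mem Y.mem, Submodule.mem_bot] at h₁
    rw [h.meshIdeal_section_eq_bot, Submodule.mem_bot, ← key]
    refine h₁.trans (map_eq_zero_iff _ (mapPathHom_injective _ fun p q hpq => ?_))
    exact vertexIncl_mapPath_injective h.subset p q hpq

end IsTauSection

theorem IsStandard.hom_eq_zero {S : Set C} (hst : IsStandard k S) {X Y : C} (hX : X ∈ S)
    (hY : Y ∈ S) (hXY : ¬ Relation.ReflTransGen (ArrowIn k S) X Y) (f : X ⟶ Y) : f = 0 := by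
  obtain ⟨-, σ, φ, hφ⟩ := (isStandard_iff k S).mp hst
  obtain ⟨g, rfl⟩ := (hφ ⟨X, hX⟩ ⟨Y, hY⟩).1 f
  rw [hom_eq_zero_of_isEmpty ⟨fun p => hXY (reflTransGen_of_path p)⟩ g, map_zero]

theorem IsTauSection.homVanish {Γ Δ : Set C} (h : IsTauSection k Γ Δ) (hst : IsStandard k Γ) :
    HomVanish (plusPart Γ Δ) (Δ ∪ minusPart Γ Δ) ∧ HomVanish Δ (minusPart Γ Δ) := by
  refine ⟨fun X hX Y hY => ?_, fun X hX Y hY => ?_⟩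
  · have hY' : Y ∉ plusPart Γ Δ := hY.elim h.notMem_plusPart
      fun hY h' => h.notMem_minusPart_of_mem_plusPart h' hY
    have hYΓ : Y ∈ Γ := hY.elim (fun hY => h.subset hY) fun hY => minusPart_subset hY
    exact hst.hom_eq_zero (plusPart_subset hX) hYΓ fun p =>
      hY' (h.mem_plusPart_of_path hX hYΓ p)
  · exact hst.hom_eq_zero (h.subset hX) (minusPart_subset hY) fun p =>
      h.notMem_minusPart hX (h.mem_minusPart_of_path hY (h.subset hX) p)

end MeshComponent

/-! ### Construction of the functor by recursion along the meshes -/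

/-- Recursion with a choice at each step that is possible only if earlier choices satisfy an
invariant `Q`. The recursion therefore runs in the subtype cut out by `Q`, and `P` records the
relation to the earlier choices. -/
theorem WellFounded.exists_choice {V : Type*} {R : V → V → Prop} (hR : WellFounded R)
    {T : V → Type*} {Q : ∀ z, T z → Prop} {P : ∀ z, (∀ y, R y z → T y) → T z → Prop}
    (step : ∀ z (prev : ∀ y, R y z → T y), (∀ y h, Q y (prev y h)) → ∃ t, Q z t ∧ P z prev t) :
    ∃ t : ∀ z, T z, ∀ z, Q z (t z) ∧ P z (fun y _ => t y) (t z) := by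
  let F : ∀ z, (∀ y, R y z → {t : T y // Q y t}) → {t : T z // Q z t} := fun z prev =>
    ⟨(step z (fun y h => (prev y h).1) fun y h => (prev y h).2).choose,
      (step z (fun y h => (prev y h).1) fun y h => (prev y h).2).choose_spec.1⟩
  refine ⟨fun z => (hR.fix F z).1, fun z => ⟨(hR.fix F z).2, ?_⟩⟩
  have e : hR.fix F z = F z fun y _ => hR.fix F y := hR.fix_eq F z
  beta_reduce
  rw [e]
  exact (step z (fun y h => (hR.fix F y).1) fun y h => (hR.fix F y).2).choose_spec.2

section Translation

variable {k : Type w} {C : Type u} [Category.{v} C] [Preadditive C] {Γ Δ : Set C}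

theorem exists_vertexTau_of_mem_plusPart {Z : Vertex k Γ} (hZ : Z.obj ∈ plusPart Γ Δ) :
    ∃ X, vertexTau k Γ X Z := by
  obtain ⟨Y, -, p⟩ := hZ
  obtain ⟨X, hX, -⟩ := Relation.TransGen.head'_iff.mp p
  exact ⟨⟨X, hX.2.1⟩, hX.2.2⟩

theorem exists_vertexTau_of_mem_minusPart {X : Vertex k Γ} (hX : X.obj ∈ minusPart Γ Δ) :
    ∃ Z, vertexTau k Γ X Z := by
  obtain ⟨Y, -, p⟩ := hX
  obtain ⟨Z, -, hZ⟩ := Relation.TransGen.tail'_iff.mp p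
  exact ⟨⟨Z, hZ.1⟩, hZ.2.2⟩

theorem tauStep_of_vertexTau {X Z : Vertex k Γ} (hXZ : vertexTau k Γ X Z) :
    TauStep Γ Z.obj X.obj := ⟨Z.mem, X.mem, hXZ⟩

end Translation

section Construction

variable {k : Type w} [Field k] {C : Type u} [Category.{v} C] [Preadditive C] [Linear k C]
  {Γ Δ : Set C}

/-- The relation is placed on all of Γ, with the vertices outside `S` isolated, so that recursion
and induction can range over the whole component. -/
theorem wellFounded_of_not_hasLeftInfinitePath {S : Set C} (hS : ¬ HasLeftInfinitePath k S) :
    WellFounded fun Y Z : Vertex k Γ => (Y.obj ∈ S ∧ Z.obj ∈ S) ∧ Nonempty (Y ⟶ Z) := by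
  refine wellFounded_iff_isEmpty_descending_chain.mpr ⟨fun ⟨p, hp⟩ => hS ?_⟩
  exact ⟨fun i => (p i).obj, fun i => ⟨(hp i).1.1, (hp i).1.2, (hp i).2.some.pos⟩⟩

theorem wellFounded_of_not_hasRightInfinitePath {S : Set C} (hS : ¬ HasRightInfinitePath k S) :
    WellFounded fun Y Z : Vertex k Γ => (Y.obj ∈ S ∧ Z.obj ∈ S) ∧ Nonempty (Z ⟶ Y) := by
  refine wellFounded_iff_isEmpty_descending_chain.mpr ⟨fun ⟨p, hp⟩ => hS ?_⟩
  exact ⟨fun i => (p i).obj, fun i => ⟨(hp i).1.2, (hp i).1.1, (hp i).2.some.pos⟩⟩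

variable (h : IsMeshComponent k Γ) (hs : IsTauSection k Γ Δ)

namespace IsTauSection

include h hs in
/-- In a standard section, the images of the arrows span the irreducible morphisms. -/
theorem spansIrr (φ : ∀ ⦃X Y : Vertex k Δ⦄, (X ⟶ Y) → (X.obj ⟶ Y.obj))
    (hφ : ∀ X Y : Vertex k Δ, Function.Surjective (evalHom k φ X Y)) (X Y : Vertex k Δ) :
    SpansIrr k (φ (X := X) (Y := Y)) := by
  have hloc : ∀ X : Vertex k Δ, IsLocalObj X.obj := fun X =>
    h.isLocalObj ⟨X.obj, hs.subset X.mem⟩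
  have hinj : ∀ X Y : Vertex k Δ, Nonempty (X.obj ≅ Y.obj) → X = Y := fun X Y e =>
    Vertex.ext (congrArg (Vertex.obj (S := Γ))
      (h.eq_of_iso ⟨X.obj, hs.subset X.mem⟩ ⟨Y.obj, hs.subset Y.mem⟩ e))
  have hac := hs.isSection.2.2.1
  have hrad : ∀ {X Y : Vertex k Δ} (a : X ⟶ Y), φ a ∈ rad k X.obj Y.obj := fun {X Y} a =>
    mem_rad_of_ne hloc hinj (by rintro rfl; exact (hac.isEmpty_hom X).elim a) _
  refine ⟨hrad, fun r hr => ?_⟩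
  obtain ⟨f, rfl⟩ := hφ X Y r
  -- Acyclicity leaves only the trivial path from `X` to itself, so a radical endomorphism of `X` is
  -- zero. For distinct vertices, paths of length one span and longer ones lie in rad².
  by_cases hXY : X = Y
  · subst hXY
    have key : ∀ f : pathOb k X ⟶ pathOb k X, ∃ l : k, f = l • 𝟙 (pathOb k X) := by
      intro f
      induction f using pathHom_induction with
      | zero => exact ⟨0, (zero_smul k _).symm⟩
      | add f g hf hg =>
        obtain ⟨l, rfl⟩ := hf
        obtain ⟨l', rfl⟩ := hg
        exact ⟨l + l', (add_smul l l' _).symm⟩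
      | smul a f hf =>
        obtain ⟨l, rfl⟩ := hf
        exact ⟨a * l, (mul_smul a l _).symm⟩
      | path p => exact ⟨1, by rw [hac.path_eq_nil p, pathHom_nil, one_smul]⟩
    obtain ⟨l, rfl⟩ := key f
    rw [map_smul, evalHom_id] at hr ⊢
    rw [smul_id_mem_rad (hloc X).id_ne_zero hr, zero_smul]
    exact zero_mem _
  · clear hr
    induction f using pathHom_induction with
    | zero => rw [map_zero]; exact zero_mem _
    | add f g hf hg => rw [map_add]; exact add_mem hf hg
    | smul a f hf => rw [map_smul]; exact Submodule.smul_mem _ a hf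
    | path p =>
      rw [evalHom_pathHom]
      cases p with
      | nil => exact absurd rfl hXY
      | cons p a =>
        cases p with
        | nil =>
          refine Submodule.mem_sup_right (Submodule.subset_span ⟨a, ?_⟩)
          exact (Category.id_comp _).symm
        | cons p b =>
          exact Submodule.mem_sup_left (comp_mem_radSq (comp_mem_rad _ (hrad b)) (hrad a))

variable (σ : Polarization (vertexTau k Γ))
  {φ₀ : ∀ ⦃X Y : Vertex k Γ⦄, (X ⟶ Y) → (X.obj ⟶ Y.obj)}
  (hφ₀ : ∀ X Y : Vertex k Γ, X.obj ∈ Δ → Y.obj ∈ Δ → SpansIrr k (φ₀ (X := X) (Y := Y)))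

include hs in
theorem notMem_minusPart_of_hom {X W : Vertex k Γ} (hX : X.obj ∉ minusPart Γ Δ) (a : X ⟶ W) :
    W.obj ∉ minusPart Γ Δ :=
  fun hW => hX (hs.mem_minusPart_of_path hW X.mem (.single (arrowIn_of_hom a)))

include hs in
theorem notMem_plusPart_of_hom {W Z : Vertex k Γ} (hZ : Z.obj ∉ plusPart Γ Δ) (a : W ⟶ Z) :
    W.obj ∉ plusPart Γ Δ :=
  fun hW => hZ (hs.mem_plusPart_of_path hW Z.mem (.single (arrowIn_of_hom a)))

include hs in
theorem mem_section {X : Vertex k Γ} (h₁ : X.obj ∉ plusPart Γ Δ) (h₂ : X.obj ∉ minusPart Γ Δ) :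
    X.obj ∈ Δ :=
  (hs.trichotomy X.mem).resolve_right fun h => h.elim h₁ h₂

-- All arrows into a vertex `Z` of Δ⁺ receive their images together, by completing the images of the
-- arrows out of τZ to a mesh. Those end in vertices `W` with an arrow to `Z`: if `W` is in Δ⁺ it
-- has been treated earlier, and otherwise τZ and `W` are both in Δ, where `φ₀` is given.
open scoped Classical in
include h hs hφ₀ in
theorem exists_arrows_into_plusPart (hplus : ¬ HasLeftInfinitePath k (plusPart Γ Δ)) :
    ∃ t : ∀ Z W : Vertex k Γ, (W ⟶ Z) → (W.obj ⟶ Z.obj), ∀ Z, Z.obj ∈ plusPart Γ Δ →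
      (∀ W, SpansIrr k (t Z W)) ∧
      ∀ (X : Vertex k Γ) (hXZ : vertexTau k Γ X Z) [Fintype (Σ W : Vertex k Γ, (W ⟶ Z))],
        IsMesh k (fun b : (Σ W : Vertex k Γ, (W ⟶ Z)) =>
          if b.1.obj ∈ plusPart Γ Δ then t b.1 X (σ hXZ b.1 b.2) else φ₀ (σ hXZ b.1 b.2))
          (fun b => t Z b.1 b.2) := by
  have ⟨t, ht⟩ := WellFounded.exists_choice
    (wellFounded_of_not_hasLeftInfinitePath (Γ := Γ) hplus)
    (T := fun Z => ∀ W : Vertex k Γ, (W ⟶ Z) → (W.obj ⟶ Z.obj))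
    (Q := fun Z t => Z.obj ∈ plusPart Γ Δ → ∀ W, SpansIrr k (t W))
    (P := fun Z prev t => Z.obj ∈ plusPart Γ Δ →
      ∀ (X : Vertex k Γ) (hXZ : vertexTau k Γ X Z) [Fintype (Σ W : Vertex k Γ, (W ⟶ Z))],
        IsMesh k (fun b : (Σ W : Vertex k Γ, (W ⟶ Z)) =>
          if hb : (b.1.obj ∈ plusPart Γ Δ ∧ Z.obj ∈ plusPart Γ Δ) ∧ Nonempty (b.1 ⟶ Z)
          then prev b.1 hb X (σ hXZ b.1 b.2) else φ₀ (σ hXZ b.1 b.2))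
          (fun b => t b.1 b.2)) ?_
  · refine ⟨t, fun Z hZ => ⟨(ht Z).1 hZ, fun X hXZ _ => ?_⟩⟩
    have := (ht Z).2 hZ X hXZ
    convert this using 2 with b
    by_cases hb : b.1.obj ∈ plusPart Γ Δ
    · rw [if_pos hb, dif_pos ⟨⟨hb, hZ⟩, ⟨b.2⟩⟩]
    · rw [if_neg hb, dif_neg fun h => hb h.1.1]
  · intro Z prev hprev
    by_cases hZ : Z.obj ∈ plusPart Γ Δ
    · obtain ⟨X, hXZ⟩ := exists_vertexTau_of_mem_plusPart hZ
      have hX := hs.tau_notMem_minusPart (tauStep_of_vertexTau hXZ) hZ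
      have := h.finite_arrows hXZ
      have := Fintype.ofFinite (Σ W : Vertex k Γ, (W ⟶ Z))
      obtain ⟨t, ht, hm⟩ := h.exists_isMesh_right σ hXZ
        (fun W a =>
          if hb : (W.obj ∈ plusPart Γ Δ ∧ Z.obj ∈ plusPart Γ Δ) ∧ Nonempty (W ⟶ Z)
          then prev W hb X a else φ₀ a) (by
          rintro W ⟨a⟩
          have hW' : Nonempty (W ⟶ Z) := ⟨(σ hXZ W).symm a⟩
          by_cases hW : W.obj ∈ plusPart Γ Δ
          · simp only [dif_pos (show (W.obj ∈ plusPart Γ Δ ∧ Z.obj ∈ plusPart Γ Δ) ∧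
              Nonempty (W ⟶ Z) from ⟨⟨hW, hZ⟩, hW'⟩)]
            exact hprev W _ hW X
          · simp only [dif_neg (show ¬ ((W.obj ∈ plusPart Γ Δ ∧ Z.obj ∈ plusPart Γ Δ) ∧
              Nonempty (W ⟶ Z)) from fun h => hW h.1.1)]
            exact hφ₀ X W (hs.mem_section (hs.notMem_plusPart_of_hom hW a) hX)
              (hs.mem_section hW (hs.notMem_minusPart_of_hom hX a)))
      refine ⟨t, fun _ => ht, fun _ X' hXZ' _ => ?_⟩
      -- Only one mesh ends in `Z`, so the images chosen for it meet every requirement on `Z`.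
      obtain rfl : X' = X := Vertex.ext
        (hs.tau_unique (tauStep_of_vertexTau hXZ') (tauStep_of_vertexTau hXZ))
      convert hm
    · exact ⟨fun _ _ => 0, fun h => absurd h hZ, fun h => absurd h hZ⟩

-- Dual construction: all arrows out of a vertex of Δ⁻ are treated together, after those out of its
-- successors in Δ⁻.
open scoped Classical in
include h hs hφ₀ in
theorem exists_arrows_from_minusPart (hminus : ¬ HasRightInfinitePath k (minusPart Γ Δ)) :
    ∃ t : ∀ X W : Vertex k Γ, (X ⟶ W) → (X.obj ⟶ W.obj), ∀ X, X.obj ∈ minusPart Γ Δ →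
      (∀ W, SpansIrr k (t X W)) ∧
      ∀ (Z : Vertex k Γ) (hXZ : vertexTau k Γ X Z) [Fintype (Σ W : Vertex k Γ, (W ⟶ Z))],
        IsMesh k (fun b : (Σ W : Vertex k Γ, (W ⟶ Z)) => t X b.1 (σ hXZ b.1 b.2))
          (fun b => if b.1.obj ∈ minusPart Γ Δ then t b.1 Z b.2 else φ₀ b.2) := by
  have ⟨t, ht⟩ := WellFounded.exists_choice
    (wellFounded_of_not_hasRightInfinitePath (Γ := Γ) hminus)
    (T := fun X => ∀ W : Vertex k Γ, (X ⟶ W) → (X.obj ⟶ W.obj))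
    (Q := fun X t => X.obj ∈ minusPart Γ Δ → ∀ W, SpansIrr k (t W))
    (P := fun X prev t => X.obj ∈ minusPart Γ Δ →
      ∀ (Z : Vertex k Γ) (hXZ : vertexTau k Γ X Z) [Fintype (Σ W : Vertex k Γ, (W ⟶ Z))],
        IsMesh k (fun b : (Σ W : Vertex k Γ, (W ⟶ Z)) => t b.1 (σ hXZ b.1 b.2))
          (fun b => if hb : (b.1.obj ∈ minusPart Γ Δ ∧ X.obj ∈ minusPart Γ Δ) ∧ Nonempty (X ⟶ b.1)
            then prev b.1 hb Z b.2 else φ₀ b.2)) ?_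
  · refine ⟨t, fun X hX => ⟨(ht X).1 hX, fun Z hXZ _ => ?_⟩⟩
    have := (ht X).2 hX Z hXZ
    convert this using 2 with b
    by_cases hb : b.1.obj ∈ minusPart Γ Δ
    · rw [if_pos hb, dif_pos ⟨⟨hb, hX⟩, ⟨σ hXZ b.1 b.2⟩⟩]
    · rw [if_neg hb, dif_neg fun h => hb h.1.1]
  · intro X prev hprev
    by_cases hX : X.obj ∈ minusPart Γ Δ
    · obtain ⟨Z, hXZ⟩ := exists_vertexTau_of_mem_minusPart hX
      have hZ : Z.obj ∉ plusPart Γ Δ := fun hZ =>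
        hs.tau_notMem_minusPart (tauStep_of_vertexTau hXZ) hZ hX
      have := h.finite_arrows hXZ
      have := Fintype.ofFinite (Σ W : Vertex k Γ, (W ⟶ Z))
      obtain ⟨t, ht, hm⟩ := h.exists_isMesh_left σ hXZ
        (fun W a =>
          if hb : (W.obj ∈ minusPart Γ Δ ∧ X.obj ∈ minusPart Γ Δ) ∧ Nonempty (X ⟶ W)
          then prev W hb Z a else φ₀ a) (by
          rintro W ⟨a⟩
          have hW' : Nonempty (X ⟶ W) := ⟨σ hXZ W a⟩
          by_cases hW : W.obj ∈ minusPart Γ Δ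
          · simp only [dif_pos (show (W.obj ∈ minusPart Γ Δ ∧ X.obj ∈ minusPart Γ Δ) ∧
              Nonempty (X ⟶ W) from ⟨⟨hW, hX⟩, hW'⟩)]
            exact hprev W _ hW Z
          · simp only [dif_neg (show ¬ ((W.obj ∈ minusPart Γ Δ ∧ X.obj ∈ minusPart Γ Δ) ∧
              Nonempty (X ⟶ W)) from fun h => hW h.1.1)]
            exact hφ₀ W Z (hs.mem_section (hs.notMem_plusPart_of_hom hZ a) hW)
              (hs.mem_section hZ (hs.notMem_minusPart_of_hom hW a)))
      refine ⟨t, fun _ => ht, fun _ Z' hXZ' _ => ?_⟩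
      obtain rfl : Z' = Z := Vertex.ext
        (hs.tau_inj (tauStep_of_vertexTau hXZ') (tauStep_of_vertexTau hXZ))
      convert hm
    · exact ⟨fun _ _ => 0, fun h => absurd h hX, fun h => absurd h hX⟩

end IsTauSection
end Construction

/-! ### From a standard section to a standard component -/

section Sufficiency

variable {k : Type w} [Field k] {C : Type u} [Category.{v} C] [Preadditive C] [Linear k C]
  {Γ Δ : Set C}

/-- Triviality of the automorphism fields is invariant under the translation. -/
theorem IsSection.trivialAutField (hloc : ∀ X ∈ Γ, IsLocalObj X) (hΔ : IsSection k Γ Δ)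
    (htriv : ∀ X ∈ Δ, TrivialAutField k X) : ∀ X ∈ Γ, TrivialAutField k X := by
  intro X hX
  obtain ⟨Y, ⟨hY, hXY⟩, -⟩ := hΔ.2.2.2 X hX
  have step : ∀ {A B : C}, TauStep Γ A B → (TrivialAutField k A ↔ TrivialAutField k B) := by
    rintro A B ⟨hA, hB, Y, f, g, h⟩
    rw [trivialAutField_iff (hloc A hA), trivialAutField_iff (hloc B hB)]
    exact ⟨h.scalarEnd_left (hloc B hB) (hloc A hA), h.scalarEnd_right (hloc B hB) (hloc A hA)⟩
  have key : ∀ {A B : C}, Relation.ReflTransGen (TauStep Γ) A B →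
      (TrivialAutField k A ↔ TrivialAutField k B) := by
    intro A B p
    induction p with
    | refl => exact Iff.rfl
    | tail _ h ih => exact ih.trans (step h)
  rcases hXY with p | p
  · exact (key p).mpr (htriv Y hY)
  · exact (key p).mp (htriv Y hY)

/-- Induction on `Δ⁺` along the paths of `Γ`: the vertices of a mesh ending in `Z` precede `Z`. -/
theorem IsTauSection.evalBijective_of_notMem_minusPart (h : IsMeshComponent k Γ)
    (hs : IsTauSection k Γ Δ) (hplus : ¬ HasLeftInfinitePath k (plusPart Γ Δ))
    (σ : Polarization (vertexTau k Γ)) (φ : ∀ ⦃X Y : Vertex k Γ⦄, (X ⟶ Y) → (X.obj ⟶ Y.obj))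
    (hmesh : ∀ (X Z : Vertex k Γ) (hXZ : vertexTau k Γ X Z) [Fintype (Σ W : Vertex k Γ, (W ⟶ Z))],
      IsMesh k (fun b : (Σ W : Vertex k Γ, (W ⟶ Z)) => φ (σ hXZ b.1 b.2)) (fun b => φ b.2))
    (hrad : ∀ (W Z : Vertex k Γ) (a : W ⟶ Z), Z.obj ∈ plusPart Γ Δ → φ a ∈ rad k W.obj Z.obj)
    {S : Vertex k Γ}
    (hS : ∀ Z : Vertex k Γ, Z.obj ∉ plusPart Γ Δ → EvalBijective k σ φ S Z)
    (Z : Vertex k Γ) : EvalBijective k σ φ S Z := by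
  -- The transitive closure is needed because τZ is two arrows away from `Z`. If τZ is in Δ⁺, so is
  -- the vertex between them.
  induction Z using
    (wellFounded_of_not_hasLeftInfinitePath (k := k) (Γ := Γ) hplus).transGen.induction with
  | _ Z ih =>
  by_cases hZ : Z.obj ∈ plusPart Γ Δ
  · obtain ⟨X, hXZ⟩ := exists_vertexTau_of_mem_plusPart hZ
    have := h.finite_arrows hXZ
    have := Fintype.ofFinite (Σ W : Vertex k Γ, (W ⟶ Z))
    have hW : ∀ W : Vertex k Γ, Nonempty (W ⟶ Z) → EvalBijective k σ φ S W := by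
      intro W hWZ
      by_cases hW : W.obj ∈ plusPart Γ Δ
      · exact ih W (.single ⟨⟨hW, hZ⟩, hWZ⟩)
      · exact hS W hW
    refine EvalBijective.of_mesh_right σ φ h.isLocalObj h.scalarEnd h.eq_of_iso hXZ
      (hmesh X Z hXZ) (fun b => hrad _ _ b.2 hZ) (fun b => hW b.1 ⟨b.2⟩) ?_
    by_cases hX : X.obj ∈ plusPart Γ Δ
    · obtain ⟨W, ⟨a⟩, ⟨b⟩⟩ := h.exists_arrows hXZ
      have hWp : W.obj ∈ plusPart Γ Δ := by
        by_contra hW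
        exact hs.notMem_plusPart_of_hom hW a hX
      exact ih X (.tail (.single ⟨⟨hX, hWp⟩, ⟨a⟩⟩) ⟨⟨hWp, hZ⟩, ⟨b⟩⟩)
    · exact hS X hX
  · exact hS Z hZ

/-- Induction on `Δ⁻` along the paths of `Γ`: the vertices of a mesh starting in `X` follow `X`. -/
theorem IsTauSection.evalBijective_of_notMem_plusPart (h : IsMeshComponent k Γ)
    (hs : IsTauSection k Γ Δ) (hminus : ¬ HasRightInfinitePath k (minusPart Γ Δ))
    (σ : Polarization (vertexTau k Γ)) (φ : ∀ ⦃X Y : Vertex k Γ⦄, (X ⟶ Y) → (X.obj ⟶ Y.obj))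
    (hmesh : ∀ (X Z : Vertex k Γ) (hXZ : vertexTau k Γ X Z) [Fintype (Σ W : Vertex k Γ, (W ⟶ Z))],
      IsMesh k (fun b : (Σ W : Vertex k Γ, (W ⟶ Z)) => φ (σ hXZ b.1 b.2)) (fun b => φ b.2))
    (hrad : ∀ (X W : Vertex k Γ) (a : X ⟶ W), X.obj ∈ minusPart Γ Δ → φ a ∈ rad k X.obj W.obj)
    {T : Vertex k Γ}
    (hT : ∀ X : Vertex k Γ, X.obj ∉ minusPart Γ Δ → EvalBijective k σ φ X T)
    (X : Vertex k Γ) : EvalBijective k σ φ X T := by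
  induction X using
    (wellFounded_of_not_hasRightInfinitePath (k := k) (Γ := Γ) hminus).transGen.induction with
  | _ X ih =>
  by_cases hX : X.obj ∈ minusPart Γ Δ
  · obtain ⟨Z, hXZ⟩ := exists_vertexTau_of_mem_minusPart hX
    have := h.finite_arrows hXZ
    have := Fintype.ofFinite (Σ W : Vertex k Γ, (W ⟶ Z))
    have hW : ∀ W : Vertex k Γ, Nonempty (X ⟶ W) → EvalBijective k σ φ W T := by
      intro W hXW
      by_cases hW : W.obj ∈ minusPart Γ Δ
      · exact ih W (.single ⟨⟨hW, hX⟩, hXW⟩)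
      · exact hT W hW
    refine EvalBijective.of_mesh_left σ φ h.isLocalObj h.scalarEnd h.eq_of_iso hXZ
      (hmesh X Z hXZ) (fun b => hrad _ _ _ hX) (fun b => hW b.1 ⟨σ hXZ b.1 b.2⟩) ?_
    by_cases hZ : Z.obj ∈ minusPart Γ Δ
    · obtain ⟨W, ⟨a⟩, ⟨b⟩⟩ := h.exists_arrows hXZ
      have hWm : W.obj ∈ minusPart Γ Δ := by
        by_contra hW
        exact hs.notMem_minusPart_of_hom hW b hZ
      exact ih Z (.tail (.single ⟨⟨hZ, hWm⟩, ⟨b⟩⟩) ⟨⟨hWm, hX⟩, ⟨a⟩⟩)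
    · exact hT Z hZ
  · exact hT X hX

/-- The three families of images, on Δ, into Δ⁺ and out of Δ⁻, are glued to one on Γ satisfying
every mesh relation. Bijectivity of the evaluation then spreads from Δ along the meshes. -/
theorem IsTauSection.isStandard (h : IsMeshComponent k Γ) (hs : IsTauSection k Γ Δ)
    (hplus : ¬ HasLeftInfinitePath k (plusPart Γ Δ))
    (hminus : ¬ HasRightInfinitePath k (minusPart Γ Δ))
    (htriv : ∀ X ∈ Γ, TrivialAutField k X) (hst : IsStandard k Δ)
    (hv : HomVanish (plusPart Γ Δ) (Δ ∪ minusPart Γ Δ)) (hv' : HomVanish Δ (minusPart Γ Δ)) :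
    IsStandard k Γ := by
  classical
  obtain ⟨-, σ', φ', hφ'⟩ := (isStandard_iff k Δ).mp hst
  -- Any polarization will do, since the images of the arrows are adapted to it.
  obtain ⟨σ⟩ := h.nonempty_polarization
  let φ₀ : ∀ ⦃X Y : Vertex k Γ⦄, (X ⟶ Y) → (X.obj ⟶ Y.obj) := fun X Y a =>
    if hXY : X.obj ∈ Δ ∧ Y.obj ∈ Δ then
      φ' (X := ⟨X.obj, hXY.1⟩) (Y := ⟨Y.obj, hXY.2⟩) a else 0
  have hφ₀eq : ∀ (X Y : Vertex k Δ) (a : X ⟶ Y),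
      φ₀ ((vertexIncl k hs.subset).map a) = φ' a := fun X Y a =>
    dif_pos (show X.obj ∈ Δ ∧ Y.obj ∈ Δ from ⟨X.mem, Y.mem⟩)
  have hφ₀ : ∀ X Y : Vertex k Γ, X.obj ∈ Δ → Y.obj ∈ Δ → SpansIrr k (φ₀ (X := X) (Y := Y)) := by
    intro X Y hX hY
    have e : (φ₀ (X := X) (Y := Y)) = φ' (X := ⟨X.obj, hX⟩) (Y := ⟨Y.obj, hY⟩) :=
      funext fun a => hφ₀eq ⟨X.obj, hX⟩ ⟨Y.obj, hY⟩ a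
    rw [e]
    exact hs.spansIrr h φ' (fun X Y => (hφ' X Y).1) _ _
  obtain ⟨t, ht⟩ := hs.exists_arrows_into_plusPart h σ hφ₀ hplus
  obtain ⟨t', ht'⟩ := hs.exists_arrows_from_minusPart h σ hφ₀ hminus
  -- An arrow reaching the last case has both ends in Δ, because no arrow leads from Δ⁺ out of Δ⁺ or
  -- from outside Δ⁻ into Δ⁻. So the default value zero of `φ₀` is never taken.
  let φ : ∀ ⦃X Y : Vertex k Γ⦄, (X ⟶ Y) → (X.obj ⟶ Y.obj) := fun X Y a =>
    if Y.obj ∈ plusPart Γ Δ then t Y X a else if X.obj ∈ minusPart Γ Δ then t' X Y a else φ₀ a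
  have hφplus : ∀ {X Y : Vertex k Γ} (a : X ⟶ Y), Y.obj ∈ plusPart Γ Δ → φ a = t Y X a :=
    fun a hY => if_pos hY
  have hφminus : ∀ {X Y : Vertex k Γ} (a : X ⟶ Y), Y.obj ∉ plusPart Γ Δ →
      X.obj ∈ minusPart Γ Δ → φ a = t' X Y a :=
    fun a hY hX => (if_neg hY).trans (if_pos hX)
  have hφzero : ∀ {X Y : Vertex k Γ} (a : X ⟶ Y), Y.obj ∉ plusPart Γ Δ →
      X.obj ∉ minusPart Γ Δ → φ a = φ₀ a :=
    fun a hY hX => (if_neg hY).trans (if_neg hX)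
  -- No arrow leads from Δ⁻ to Δ⁺: with `X = τZ` there is also an arrow from `Y` to `Z`, and `Z` is
  -- outside Δ⁺.
  have hnotplus : ∀ {X Y : Vertex k Γ} (a : X ⟶ Y), X.obj ∈ minusPart Γ Δ →
      Y.obj ∉ plusPart Γ Δ := by
    intro X Y a hX
    obtain ⟨Z, hXZ⟩ := exists_vertexTau_of_mem_minusPart hX
    exact hs.notMem_plusPart_of_hom
      (fun hZ => hs.tau_notMem_minusPart (tauStep_of_vertexTau hXZ) hZ hX) ((σ hXZ Y).symm a)
  have hmesh : ∀ (X Z : Vertex k Γ) (hXZ : vertexTau k Γ X Z)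
      [Fintype (Σ W : Vertex k Γ, (W ⟶ Z))],
      IsMesh k (fun b : (Σ W : Vertex k Γ, (W ⟶ Z)) => φ (σ hXZ b.1 b.2))
        (fun b => φ b.2) := by
    intro X Z hXZ _
    by_cases hZ : Z.obj ∈ plusPart Γ Δ
    · have hX := hs.tau_notMem_minusPart (tauStep_of_vertexTau hXZ) hZ
      convert (ht Z hZ).2 X hXZ using 2 with b b
      · by_cases hb : b.1.obj ∈ plusPart Γ Δ
        · rw [if_pos hb, hφplus _ hb]
        · rw [if_neg hb, hφzero _ hb hX]
      · exact hφplus _ hZ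
    · have hX := hs.tau_mem_minusPart (tauStep_of_vertexTau hXZ) hZ
      convert (ht' X hX).2 Z hXZ using 2 with b b
      · exact hφminus _ (hs.notMem_plusPart_of_hom hZ b.2) hX
      · by_cases hb : b.1.obj ∈ minusPart Γ Δ
        · rw [if_pos hb, hφminus _ hZ hb]
        · rw [if_neg hb, hφzero _ hZ hb]
  have hbase : ∀ X Z : Vertex k Γ, X.obj ∈ Δ → Z.obj ∈ Δ → EvalBijective k σ φ X Z := by
    intro X Z hX hZ
    let X' : Vertex k Δ := ⟨X.obj, hX⟩
    let Z' : Vertex k Δ := ⟨Z.obj, hZ⟩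
    have e : (fun (X Y : Vertex k Δ) (a : X ⟶ Y) => φ ((vertexIncl k hs.subset).map a)) =
        fun (X Y : Vertex k Δ) a => φ' a := by
      funext X Y a
      exact (hφzero ((vertexIncl k hs.subset).map a) (hs.notMem_plusPart Y.mem)
        (hs.notMem_minusPart X.mem)).trans (hφ₀eq X Y a)
    have key : ∀ f : pathOb k X' ⟶ pathOb k Z',
        evalHom k φ _ _ (mapPathHom k (vertexIncl k hs.subset) X' Z' f) = evalHom k φ' X' Z' f :=
      fun f => (evalHom_mapPathHom (k := k) (vertexIncl k hs.subset) φ f).trans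
        (congrArg (fun ψ : ∀ ⦃X Y : Vertex k Δ⦄, (X ⟶ Y) → (X.obj ⟶ Y.obj) =>
          evalHom k ψ X' Z' f) e)
    constructor
    · intro g
      obtain ⟨f, hf⟩ := (hφ' X' Z').1 g
      exact ⟨_, (key f).trans hf⟩
    · intro f hf
      obtain ⟨f, rfl⟩ := hs.isSection.2.1.mapPathHom_surjective X' Z' f
      have h₁ := ((hφ' X' Z').2 f).mp ((key f).symm.trans hf)
      rw [hs.meshIdeal_section_eq_bot, Submodule.mem_bot] at h₁
      rw [h₁, map_zero]
      exact zero_mem _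
  have hpath : ∀ {X Z : Vertex k Γ}, Quiver.Path X Z → X.obj ∉ minusPart Γ Δ →
      Z.obj ∉ minusPart Γ Δ := fun p hX hZ =>
    hX (hs.mem_minusPart_of_path hZ (Vertex.mem _) (reflTransGen_of_path p))
  have hpath' : ∀ {X Z : Vertex k Γ}, Quiver.Path X Z → X.obj ∈ plusPart Γ Δ →
      Z.obj ∈ plusPart Γ Δ := fun p hX =>
    hs.mem_plusPart_of_path hX (Vertex.mem _) (reflTransGen_of_path p)
  -- The source is fixed outside Δ⁻ and the target moves through Δ⁺. For targets outside Δ⁺ either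
  -- both sides vanish, by the absence of paths and the Hom hypotheses, or both vertices lie in Δ.
  have hnonminus : ∀ S : Vertex k Γ, S.obj ∉ minusPart Γ Δ → ∀ Z, EvalBijective k σ φ S Z := by
    intro S hS
    refine hs.evalBijective_of_notMem_minusPart h hplus σ φ hmesh
      (fun W Z a hZ => by rw [hφplus a hZ]; exact ((ht Z hZ).1 W).1 a) fun Z hZ => ?_
    by_cases hS' : S.obj ∈ plusPart Γ Δ
    · refine .of_isEmpty σ φ ⟨fun p => hZ (hpath' p hS')⟩ (hv _ hS' _ ?_)
      by_cases hZ' : Z.obj ∈ minusPart Γ Δ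
      · exact Or.inr hZ'
      · exact Or.inl (hs.mem_section hZ hZ')
    · have hSΔ := hs.mem_section hS' hS
      by_cases hZ' : Z.obj ∈ minusPart Γ Δ
      · exact .of_isEmpty σ φ ⟨fun p => hpath p hS hZ'⟩ (hv' _ hSΔ _ hZ')
      · exact hbase S Z hSΔ (hs.mem_section hZ hZ')
  -- Now the target is arbitrary and the source moves through Δ⁻, starting from the sources just
  -- settled.
  have hall : ∀ X Z : Vertex k Γ, EvalBijective k σ φ X Z := fun X Z =>
    hs.evalBijective_of_notMem_plusPart h hminus σ φ hmesh
      (fun X W a hX => by rw [hφminus a (hnotplus a hX) hX]; exact ((ht' X hX).1 W).1 a)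
      (fun X hX => hnonminus X hX Z) X
  refine (isStandard_iff k Γ).mpr ⟨htriv, σ, φ, fun X Y => ⟨(hall X Y).1, fun f =>
    ⟨(hall X Y).2 f, evalHom_eq_zero_of_mem_meshIdeal σ φ fun X Z hXZ => ?_⟩⟩⟩
  have := h.finite_arrows hXZ
  have := Fintype.ofFinite (Σ W : Vertex k Γ, (W ⟶ Z))
  rw [meshElement_eq_sum, map_sum]
  simpa only [evalHom_comp, evalHom_arrowMap] using (hmesh X Z hXZ).sum_comp

end Sufficiency
end ARTheory

theorem theorem1p4 {k : Type w} [Field k] {C : Type u} [CategoryTheory.Category.{v} C]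
    [CategoryTheory.Preadditive C] [CategoryTheory.Linear k C]
    [CategoryTheory.Limits.HasFiniteBiproducts C]
    (hfin : ARTheory.HomFinite k C) (hKS : ARTheory.KrullSchmidt C)
    (ind : Set C) (hind : ARTheory.IsVertexSet ind)
    (Γ Δ : Set C) (hΓ : ARTheory.IsComponent k ind Γ) (hΔ : ARTheory.IsSection k Γ Δ)
    (hplus : ¬ ARTheory.HasLeftInfinitePath k (ARTheory.plusPart Γ Δ))
    (hminus : ¬ ARTheory.HasRightInfinitePath k (ARTheory.minusPart Γ Δ)) :
    ARTheory.IsStandard k Γ ↔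
      ARTheory.IsStandard k Δ ∧
        ARTheory.HomVanish (ARTheory.plusPart Γ Δ) (Δ ∪ ARTheory.minusPart Γ Δ) ∧
        ARTheory.HomVanish Δ (ARTheory.minusPart Γ Δ) := by
  constructor
  · intro hst
    have hs := (hΓ.isMeshComponent hfin hKS hind hst.1).isTauSection hΔ
    exact ⟨hs.isStandard_of_isStandard hst, hs.homVanish hst⟩
  · rintro ⟨hst, hv, hv'⟩
    -- Standardness of Δ gives trivial automorphism fields only on Δ; they must be known on Γ before
    -- its meshes can be described by arrows.
    have htriv := hΔ.trivialAutField (fun X hX =>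
      ARTheory.isLocalObj_of_isIndec hKS (hind.1 X (hΓ.subset hX))) hst.1
    have h := hΓ.isMeshComponent hfin hKS hind htriv
    exact (h.isTauSection hΔ).isStandard h hplus hminus htriv hst hv hv'
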